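/- Let $\alpha>0$, $0\le\eta<1$ and $a\in(0,1)\cup(1,\infty)$. Write $\log$ for the logarithm to base $2$, $|\beta\rangle$ for the coherent state of amplitude $\beta$ of one bosonic mode, and $q=(\mathsf a+\mathsf a^\dagger)/\sqrt2$ for its position quadrature ($\mathsf a$ being the annihilation operator). Alice sends $|(-1)^x\alpha\rangle$ with $x\in\{0,1\}$ uniform through a pure-loss channel of transmittance $\eta$; Bob receives $|(-1)^x\sqrt\eta\,\alpha\rangle$ and Eve receives $|(-1)^x\sqrt{1-\eta}\,\alpha\rangle$. Bob measures $q$ by homodyne detection and sets $y=0$ if the outcome is $q>0$ and $y=1$ otherwise; let $p(y|x)$ be the resulting conditional probabilities. Put $\gamma=\sqrt{1-\eta}\,\alpha$ and $$\rho_{YE}=\frac12\sum_{y=0,1}|y\rangle\langle y|\otimes\rho_{E|y},\qquad \rho_{E|y}=\sum_{x=0,1}p(y|x)\,|(-1)^x\gamma\rangle\langle(-1)^x\gamma|,\qquad \rho_E=\mathrm{tr}_Y\,\rho_{YE}.$$ For the Rényi divergences $$D_a(\rho\|\sigma)=\tfrac1{a-1}\log\mathrm{tr}\big(\rho^a\sigma^{1-a}\big),\qquad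 \tilde D_a(\rho\|\sigma)=\tfrac1{a-1}\log\mathrm{tr}\Big[\big(\sigma^{\frac{1-a}{2a}}\rho\,\sigma^{\frac{1-a}{2a}}\big)^a\Big]$$ (negative powers being taken on the support, and the value being $+\infty$ if $a>1$ and the support of $\rho$ is not contained in that of $\sigma$, or if $a<1$ and the trace vanishes) let $$H_a^\downarrow(Y|E)=-D_a(\rho_{YE}\|\mathbb I_Y\otimes\rho_E),\quad H_a^\uparrow(Y|E)=\sup_{\sigma_E}-D_a(\rho_{YE}\|\mathbb I_Y\otimes\sigma_E),\quad \tilde H_a^\downarrow(Y|E)=-\tilde D_a(\rho_{YE}\|\mathbb I_Y\otimes\rho_E),$$ where the supremum is over all density operators $\sigma_E$ of Eve's mode. Define $$\kappa=e^{2\alpha^2(\eta-1)},\quad r=\operatorname{erf}(\sqrt{2\eta}\,\alpha),\quad g=\sqrt{1+(\kappa^{-2}-1)r^2},\quad \theta=\operatorname{artanh}(\kappa g),\quad \phi=\operatorname{artanh}\kappa,\quad \Delta=\sqrt{r^2+\sinh^2(\phi/a)},$$ with $\operatorname{erf}(x)=\frac2{\sqrt\pi}\int_0^xe^{-t^2}\,dt$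 and $\operatorname{sech}x=1/\cosh x$. Then $$H_a^\downarrow(Y|E)=1+\frac1{1-a}\log\Big\{\operatorname{sech}^a\theta\;\operatorname{sech}^{1-a}\phi\,\big[\cosh(a\theta)\cosh((1-a)\phi)+g^{-1}\sinh(a\theta)\sinh((1-a)\phi)\big]\Big\},$$ $$H_a^\uparrow(Y|E)=\frac a{1-a}\log\Big[2^{\frac1a-2}\operatorname{sech}\theta\,\Big(\big(\cosh(a\theta)+g^{-1}\sinh(a\theta)\big)^{1/a}+\big(\cosh(a\theta)-g^{-1}\sinh(a\theta)\big)^{1/a}\Big)\Big],$$ $$\tilde H_a^\downarrow(Y|E)=-\frac{2a}{1-a}+\frac1{1-a}\log\Big[2^a\operatorname{sech}\phi\,\Big(\big(\cosh(\tfrac\phi a)-\Delta\big)^a+\big(\cosh(\tfrac\phi a)+\Delta\big)^a\Big)\Big].$$ -/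

import Mathlib

open MeasureTheory
open scoped ENNReal Topology InnerProductSpace

noncomputable section

namespace BPSK

/-! ### Traces and Rényi divergences of positive operators on a Hilbert space -/

section Divergences

variable {H : Type*} [NormedAddCommGroup H] [InnerProductSpace ℂ H] [CompleteSpace H]

/-- An index set of an orthonormal basis of `H`. -/
def basisIndex (H : Type*) [NormedAddCommGroup H] [InnerProductSpace ℂ H] [CompleteSpace H] :
    Set H :=
  (exists_hilbertBasis ℂ H).choose

/-- An orthonormal (Hilbert) basis of `H`. -/
def onb (H : Type*) [NormedAddCommGroup H] [InnerProductSpace ℂ H] [CompleteSpace H] :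
    HilbertBasis (basisIndex H) ℂ H :=
  (exists_hilbertBasis ℂ H).choose_spec.choose

/-- The trace `∑ᵢ ⟨bᵢ, T bᵢ⟩ ∈ [0, ∞]` of a positive bounded operator `T`
(for positive `T` it does not depend on the orthonormal basis `b`). -/
def trace (T : H →L[ℂ] H) : ℝ≥0∞ :=
  ∑' i, ENNReal.ofReal (⟪onb H i, T (onb H i)⟫_ℂ).re

/-- Density operators: positive operators of trace one. -/
def IsDensity (T : H →L[ℂ] H) : Prop :=
  T.IsPositive ∧ trace T = 1

/-- `tr (ρ ^ a σ ^ (1 - a))`, written in the symmetric form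
`tr (ρ ^ (a / 2) σ ^ (1 - a) ρ ^ (a / 2)) ∈ [0, ∞]`. For `a > 1` the negative power of `σ` is
the limit of the negative powers of `σ + ε` as `ε ↓ 0`; this is the power of `σ` on its support
when `ρ ≪ σ`, and it gives the value `∞` when the support of `ρ` is not contained in that of
`σ`. -/
def petzQ (a : ℝ) (ρ σ : H →L[ℂ] H) : ℝ≥0∞ :=
  if a < 1 then
    trace (CFC.rpow ρ (a / 2) * CFC.rpow σ (1 - a) * CFC.rpow ρ (a / 2))
  else
    Filter.liminf (fun ε : ℝ => trace
      (CFC.rpow ρ (a / 2) * CFC.rpow (σ + (ε : ℂ) • 1) (1 - a) * CFC.rpow ρ (a / 2))) (𝓝[>] 0)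

/-- `tr ((σ ^ s ρ σ ^ s) ^ a) ∈ [0, ∞]` with `s = (1 - a) / (2 a)`, with the same reading of the
negative powers of `σ` when `a > 1`. -/
def sandwichedQ (a : ℝ) (ρ σ : H →L[ℂ] H) : ℝ≥0∞ :=
  if a < 1 then
    trace (CFC.rpow
      (CFC.rpow σ ((1 - a) / (2 * a)) * ρ * CFC.rpow σ ((1 - a) / (2 * a))) a)
  else
    Filter.liminf (fun ε : ℝ => trace (CFC.rpow
      (CFC.rpow (σ + (ε : ℂ) • 1) ((1 - a) / (2 * a)) * ρ *
        CFC.rpow (σ + (ε : ℂ) • 1) ((1 - a) / (2 * a))) a)) (𝓝[>] 0)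

/-- The logarithm to base two on `[0, ∞]`, with values in `[-∞, ∞]`. -/
def log2 (x : ℝ≥0∞) : EReal :=
  ((1 / Real.log 2 : ℝ) : EReal) * ENNReal.log x

/-- The Petz-Rényi divergence `D_a(ρ ‖ σ)`. -/
def petzDiv (a : ℝ) (ρ σ : H →L[ℂ] H) : EReal :=
  ((1 / (a - 1) : ℝ) : EReal) * log2 (petzQ a ρ σ)

/-- The sandwiched Rényi divergence. -/
def sandwichedDiv (a : ℝ) (ρ σ : H →L[ℂ] H) : EReal :=
  ((1 / (a - 1) : ℝ) : EReal) * log2 (sandwichedQ a ρ σ)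

end Divergences

/-! ### A finite register `Y` next to a quantum system `E`, and conditional Rényi entropies -/

section Conditional

variable (ι : Type*) [Fintype ι]
variable (H : Type*) [NormedAddCommGroup H] [InnerProductSpace ℂ H] [CompleteSpace H]

/-- The Hilbert space `ℂ^ι ⊗ H` of the joint system, as the Hilbert sum of `ι` copies of `H`;
`|y⟩ ⊗ v` is the vector with entry `v` at `y` and zeros elsewhere. -/
abbrev Joint : Type _ := PiLp 2 (fun _ : ι => H)

variable {ι H}

/-- The operator `⟨y| ⊗ 1` from the joint system to `E`. -/
def bra (y : ι) : Joint ι H →L[ℂ] H := PiLp.proj 2 (fun _ : ι => H) y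

/-- The operator `|y⟩ ⊗ 1` from `E` to the joint system. -/
def ket (y : ι) : H →L[ℂ] Joint ι H := ContinuousLinearMap.adjoint (bra y)

/-- `|y⟩⟨y| ⊗ T`. -/
def block (y : ι) (T : H →L[ℂ] H) : Joint ι H →L[ℂ] Joint ι H :=
  ket y ∘L T ∘L bra y

/-- `1 ⊗ T`. -/
def oneTensor (T : H →L[ℂ] H) : Joint ι H →L[ℂ] Joint ι H :=
  ∑ y : ι, block y T

/-- The partial trace over the register `Y`. -/
def partialTrace (ρ : Joint ι H →L[ℂ] Joint ι H) : H →L[ℂ] H :=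
  ∑ y : ι, bra y ∘L ρ ∘L ket y

/-- Petz-Rényi conditional entropy `H_a^↓(Y|E) = -D_a(ρ_YE ‖ 1 ⊗ ρ_E)`. -/
def petzDown (a : ℝ) (ρ : Joint ι H →L[ℂ] Joint ι H) : EReal :=
  -petzDiv a ρ (oneTensor (partialTrace ρ))

/-- Optimized Petz-Rényi conditional entropy: the supremum of `-D_a(ρ_YE ‖ 1 ⊗ σ)` over all
density operators `σ` of the system `E`. -/
def petzUp (a : ℝ) (ρ : Joint ι H →L[ℂ] Joint ι H) : EReal :=
  ⨆ (σ : H →L[ℂ] H) (_ : IsDensity σ), -petzDiv a ρ (oneTensor σ)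

/-- Sandwiched Rényi conditional entropy, the negative of the sandwiched divergence of `ρ_YE`
from `1 ⊗ ρ_E`. -/
def sandwichedDown (a : ℝ) (ρ : Joint ι H →L[ℂ] Joint ι H) : EReal :=
  -sandwichedDiv a ρ (oneTensor (partialTrace ρ))

end Conditional

/-! ### Coherent states and homodyne detection -/

/-- The Hilbert space of one bosonic mode, in the position (`q` quadrature) representation. -/
abbrev Mode : Type := Lp ℂ 2 (volume : Measure ℝ)

/-- The wave function `⟨q|β⟩` of the coherent state of amplitude `β`, for
`q = (a + a†) / √2`. -/
def coherentFun (β : ℂ) (q : ℝ) : ℂ :=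
  ((Real.pi ^ (-(1 / 4) : ℝ) : ℝ) : ℂ) *
    Complex.exp (-(q : ℂ) ^ 2 / 2 + (√2 : ℝ) * β * q - β ^ 2 / 2 - (‖β‖ : ℂ) ^ 2 / 2)

theorem norm_coherentFun_sq (β : ℂ) (q : ℝ) :
    ‖coherentFun β q‖ ^ 2 = (Real.pi ^ (-(1 / 4) : ℝ)) ^ 2 * Real.exp (-(q - √2 * β.re) ^ 2) := by
  have hpi : (0 : ℝ) ≤ Real.pi ^ (-(1 / 4) : ℝ) := by positivity
  have h2 : √2 ^ 2 = (2 : ℝ) := Real.sq_sqrt (by norm_num)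
  have hre : (-(q : ℂ) ^ 2 / 2 + (√2 : ℝ) * β * q - β ^ 2 / 2 - (‖β‖ : ℂ) ^ 2 / 2).re
      = -(q - √2 * β.re) ^ 2 / 2 := by
    have hn : ‖β‖ ^ 2 = β.re ^ 2 + β.im ^ 2 := by
      rw [← Complex.normSq_eq_norm_sq, Complex.normSq_apply]; ring
    have e1 : (-(q : ℂ) ^ 2 / 2 + (√2 : ℝ) * β * q - β ^ 2 / 2 - (‖β‖ : ℂ) ^ 2 / 2)
        = ((-q ^ 2 / 2 - ‖β‖ ^ 2 / 2 : ℝ) : ℂ) + ((√2 * q : ℝ) : ℂ) * β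
          - ((1 / 2 : ℝ) : ℂ) * (β * β) := by
      push_cast; ring
    rw [e1, Complex.sub_re, Complex.add_re, Complex.re_ofReal_mul, Complex.re_ofReal_mul,
      Complex.ofReal_re, Complex.mul_re, hn]
    linear_combination (-(β.re ^ 2) / 2) * (-1 : ℝ) * h2
  rw [coherentFun, norm_mul, Complex.norm_real, Real.norm_of_nonneg hpi, Complex.norm_exp, hre,
    mul_pow, ← Real.exp_nat_mul]
  congr 2
  push_cast
  ring

theorem memLp_coherentFun (β : ℂ) : MemLp (coherentFun β) 2 (volume : Measure ℝ) := by
  have hc : Continuous (coherentFun β) := by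
    unfold coherentFun
    fun_prop
  rw [memLp_two_iff_integrable_sq_norm hc.aestronglyMeasurable]
  simp_rw [norm_coherentFun_sq]
  refine Integrable.const_mul ?_ _
  have h := (integrable_exp_neg_mul_sq (b := 1) one_pos).comp_sub_right (√2 * β.re)
  simpa using h

/-- The coherent state `|β⟩`. -/
def coherent (β : ℂ) : Mode := (memLp_coherentFun β).toLp (coherentFun β)

/-- The operator `|v⟩⟨v|`. -/
def proj (v : Mode) : Mode →L[ℂ] Mode := InnerProductSpace.rankOne ℂ v v

/-- The probability that homodyne detection of the quadrature `q` on the pure state `ψ` gives an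
outcome in `R`. -/
def homodyneProb (ψ : Mode) (R : Set ℝ) : ℝ := ∫ q in R, ‖ψ q‖ ^ 2

/-! ### The protocol -/

/-- Alice's amplitudes `(-1) ^ x α`. -/
def amplitude (α : ℝ) (x : Fin 2) : ℝ := (-1) ^ (x : ℕ) * α

/-- Bob's binning of the measured quadrature: `y = 0` if `q > 0`, and `y = 1` otherwise. -/
def region (y : Fin 2) : Set ℝ := if y = 0 then Set.Ioi 0 else Set.Iic 0

/-- The probability `p(y|x)` of Bob's bit `y` given Alice's bit `x`: the channel delivers to Bob
the coherent state of amplitude `√η (-1) ^ x α`. -/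
def bobProb (α η : ℝ) (y x : Fin 2) : ℝ :=
  homodyneProb (coherent ((√η * amplitude α x : ℝ) : ℂ)) (region y)

/-- Eve's state given Alice's bit `x`: the coherent state of amplitude `√(1 - η) (-1) ^ x α`. -/
def eveState (α η : ℝ) (x : Fin 2) : Mode →L[ℂ] Mode :=
  proj (coherent ((√(1 - η) * amplitude α x : ℝ) : ℂ))

/-- Eve's state given Bob's bit `y`. -/
def rhoEgiven (α η : ℝ) (y : Fin 2) : Mode →L[ℂ] Mode :=
  ∑ x : Fin 2, (bobProb α η y x : ℂ) • eveState α η x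

/-- The classical-quantum state `ρ_YE = (1/2) ∑ y, |y⟩⟨y| ⊗ ρ_{E|y}`. -/
def rhoYE (α η : ℝ) : Joint (Fin 2) Mode →L[ℂ] Joint (Fin 2) Mode :=
  (1 / 2 : ℂ) • ∑ y : Fin 2, block y (rhoEgiven α η y)

/-! ### Special functions -/

/-- The error function. -/
def erf (x : ℝ) : ℝ := 2 / √Real.pi * ∫ t in (0 : ℝ)..x, Real.exp (-t ^ 2)

/-- The hyperbolic secant. -/
def sech (x : ℝ) : ℝ := 1 / Real.cosh x

end BPSK

end

/-! Everything reduces to a qubit. The states |±γ⟩ have overlap κ, and in the orthonormal basis of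
their even and odd superpositions they are √((1+κ)/2) e₀ ± √((1-κ)/2) e₁. Integrating Gaussians
gives p(y|x) = (1 + (-1)^(x+y) r)/2, so ρ_{E|y} has the matrix (1 + κZ + (-1)^y r√(1-κ²) X)/2, while
ρ_E is diagonal with entries (1±κ)/2 (`rhoYE_eq`, `partialTrace_cqOp`). The bit y only flips the
sign of the off-diagonal entry: both blocks have the eigenvalues (1±κg)/2, and their eigenbases are
opposite rotations of e.

For the Petz quantities, summing over y cancels the off-diagonal entries of ρ_YE^a, so that
tr(ρ^(a/2) (1⊗S) ρ^(a/2)) = A₀⟨e₀,S e₀⟩ + A₁⟨e₁,S e₁⟩ for every S ≥ 0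
(`trace_rpow_mul_oneTensor_mul_rpow_cqOp`). Taking S = ρ_E^(1-a) gives the first formula. For the
supremum (`petzUp_of_weights`), the power 1-a is replaced by its tangents at the points tᵢ =
Aᵢ^(1/a)/N, with N = A₀^(1/a) + A₁^(1/a). There Aᵢtᵢ^(-a) takes the common value N^a, so the bound
depends only on ⟨e₀,σe₀⟩ + ⟨e₁,σe₁⟩ ≤ 1, and diag(t₀,t₁) attains it.

For the sandwiched quantity, conjugation by the diagonal operator 1⊗ρ_E^s preserves the shape of
ρ_YE, so only the eigenvalues of another real symmetric 2×2 matrix are needed (`sandwichedQ_cqOp`).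
Writing 1 ± tanh x = sech x · e^(±x) then puts all three values in hyperbolic form.

Eve's space is infinite-dimensional and σ is arbitrary there. Powers are therefore evaluated on
eigenvectors or bounded in expectation, and for a > 1 on the invertible operators σ + ε. -/

noncomputable section

namespace BPSK

/-! ### Functional calculus on eigenvectors, and traces of finite-rank operators -/

section Eigen

variable {H : Type*} [NormedAddCommGroup H] [InnerProductSpace ℂ H] [CompleteSpace H]

/-- The functions g for which g(T)v = g(μ)v form a closed subalgebra containing the constants and
the identity. By Stone–Weierstrass it contains every continuous function on the spectrum. -/
theorem cfc_apply_of_eigenvector {T : H →L[ℂ] H} (hT : IsSelfAdjoint T) {μ : ℝ} {v : H}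
    (hv : T v = (μ : ℂ) • v) {f : ℝ → ℝ} (hf : ContinuousOn f (spectrum ℝ T)) :
    cfc f T v = (f μ : ℂ) • v := by
  rcases eq_or_ne v 0 with rfl | hv0
  · simp
  have hμ : μ ∈ spectrum ℝ T := by
    rw [spectrum.mem_iff]
    intro h
    obtain ⟨u, hu⟩ := h
    have h0 : (u : H →L[ℂ] H) v = 0 := by
      rw [hu]
      simp [Algebra.algebraMap_eq_smul_one, hv]
    have h1 : (↑u⁻¹ : H →L[ℂ] H) ((u : H →L[ℂ] H) v) = v := by
      rw [← mul_apply_eq_comp, Units.inv_mul]; rfl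
    rw [h0, map_zero] at h1
    exact hv0 h1.symm
  rw [cfc_apply f T hT hf]
  have key : ∀ g : C(spectrum ℝ T, ℝ), cfcHom hT g v = (g ⟨μ, hμ⟩ : ℂ) • v := by
    intro g
    have hid : cfcHom hT (.restrict (spectrum ℝ T) <| .id ℝ) v = (μ : ℂ) • v := by
      rw [cfcHom_id hT, hv]
    induction g using ContinuousMap.induction_on_of_compact with
    | const r =>
      have : (ContinuousMap.const (spectrum ℝ T) r) = algebraMap ℝ C(spectrum ℝ T, ℝ) r := by
        ext; simp
      rw [this, AlgHomClass.commutes]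
      simp [Algebra.algebraMap_eq_smul_one]
    | id => simpa using hid
    | star_id =>
      rw [star_trivial]
      simpa using hid
    | add f g hf hg => simp [hf, hg, add_smul]
    | mul f g hf hg => simp [hf, hg, -Complex.coe_smul, smul_smul, mul_comm]
    | frequently f hf =>
      have hc : IsClosed {g : C(spectrum ℝ T, ℝ) | cfcHom hT g v = (g ⟨μ, hμ⟩ : ℂ) • v} := by
        refine isClosed_eq ?_ ?_
        · exact (ContinuousLinearMap.apply ℂ H v).continuous.comp (cfcHom_continuous hT)
        · fun_prop
      exact hc.mem_of_frequently_of_tendsto hf Filter.tendsto_id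
  rw [key]
  rfl

theorem isUnit_add_smul_one {T : H →L[ℂ] H} (hT : 0 ≤ T) {ε : ℝ} (hε : 0 < ε) :
    IsUnit (T + (ε : ℂ) • 1) := by
  have h : -ε ∉ spectrum ℝ T := fun h => by
    have := spectrum_nonneg_of_nonneg hT h
    linarith
  rw [spectrum.notMem_iff, ← IsUnit.neg_iff] at h
  convert h using 1
  ext v
  simp [Algebra.algebraMap_eq_smul_one, add_comm]

theorem smul_one_nonneg {ε : ℝ} (hε : 0 ≤ ε) : (0 : H →L[ℂ] H) ≤ (ε : ℂ) • 1 := by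
  rw [ContinuousLinearMap.nonneg_iff_isPositive]
  exact ContinuousLinearMap.isPositive_one.smul_of_nonneg (by exact_mod_cast hε)

/-- A power can fail to be continuous only at 0 and for a negative exponent; invertibility of T
keeps 0 out of the spectrum. The second alternative serves the operators σ + ε. -/
theorem continuousOn_rpow_spectrum {T : H →L[ℂ] H} {p : ℝ} (hp : 0 ≤ p ∨ IsUnit T) :
    ContinuousOn (fun x : ℝ => x ^ p) (spectrum ℝ T) := by
  refine continuousOn_id.rpow_const fun x hx => ?_
  rcases hp with hp | hp
  · exact Or.inr hp
  · refine Or.inl fun h0 => ?_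
    exact spectrum.zero_notMem ℝ hp ((show x = 0 from h0) ▸ hx)

theorem rpow_apply_of_eigenvector {T : H →L[ℂ] H} (hT : 0 ≤ T) {p : ℝ} (hp : 0 ≤ p ∨ IsUnit T)
    {μ : ℝ} {v : H} (hv : T v = (μ : ℂ) • v) :
    CFC.rpow T p v = ((μ ^ p : ℝ) : ℂ) • v := by
  rw [CFC.rpow_eq_pow, CFC.rpow_eq_cfc_real hT]
  exact cfc_apply_of_eigenvector (IsSelfAdjoint.of_nonneg hT) hv (continuousOn_rpow_spectrum hp)

/-- The operator `∑ₖ μₖ |fₖ⟩⟨fₖ|`. -/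
def eigenSum {κ : Type*} [Fintype κ] (μ : κ → ℝ) (f : κ → H) : H →L[ℂ] H :=
  ∑ k, (μ k : ℂ) • InnerProductSpace.rankOne ℂ (f k) (f k)

variable {κ : Type*} [Fintype κ] {μ : κ → ℝ} {f : κ → H}

theorem eigenSum_apply (v : H) : eigenSum μ f v = ∑ k, (μ k : ℂ) • ⟪f k, v⟫_ℂ • f k := by
  simp [eigenSum]

theorem eigenSum_nonneg (hμ : ∀ k, 0 ≤ μ k) : 0 ≤ eigenSum μ f := by
  rw [ContinuousLinearMap.nonneg_iff_isPositive]
  exact ContinuousLinearMap.isPositive_sum _ fun k _ =>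
    (InnerProductSpace.isPositive_rankOne_self _).smul_of_nonneg (by exact_mod_cast hμ k)

theorem eigenSum_apply_self (hf : Orthonormal ℂ f) (k : κ) :
    eigenSum μ f (f k) = (μ k : ℂ) • f k := by
  classical
  rw [eigenSum_apply, Finset.sum_eq_single k]
  · simp [hf.1]
  · intro j _ hj
    simp [hf.2 hj]
  · simp

theorem rpow_eigenSum (hf : Orthonormal ℂ f) (hμ : ∀ k, 0 ≤ μ k) {p : ℝ} (hp : 0 < p) :
    CFC.rpow (eigenSum μ f) p = eigenSum (fun k => μ k ^ p) f := by
  classical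
  have h0 := eigenSum_nonneg (f := f) hμ
  ext v
  -- Here w is the projection of v onto the span of f. The remainder v - w lies in the kernel, on
  -- which the power vanishes because 0 ^ p = 0 for p > 0.
  set w := ∑ k, ⟪f k, v⟫_ℂ • f k with hw
  have horth : ∀ k, ⟪f k, v - w⟫_ℂ = 0 := by
    intro k
    rw [inner_sub_right, hw, inner_sum, Finset.sum_eq_single k]
    · simp [inner_smul_right, hf.1]
    · intro j _ hj
      simp [inner_smul_right, hf.2 hj.symm]
    · simp
  have h1 : eigenSum μ f (v - w) = ((0 : ℝ) : ℂ) • (v - w) := by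
    simp [eigenSum_apply, horth]
  have h2 := rpow_apply_of_eigenvector h0 (Or.inl hp.le) h1
  rw [Real.zero_rpow hp.ne', Complex.ofReal_zero, zero_smul, map_sub, sub_eq_zero] at h2
  rw [h2, hw, map_sum, eigenSum_apply]
  refine Finset.sum_congr rfl fun k _ => ?_
  rw [map_smul, rpow_apply_of_eigenvector h0 (Or.inl hp.le) (eigenSum_apply_self hf k), smul_comm]

/-- Parseval's identity for each pair u k, w k. Positivity of the sum is needed because `trace`
truncates each diagonal entry with `ENNReal.ofReal`. -/
theorem trace_sum_rankOne (u w : κ → H)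
    (h : 0 ≤ ∑ k, InnerProductSpace.rankOne ℂ (u k) (w k)) :
    trace (∑ k, InnerProductSpace.rankOne ℂ (u k) (w k)) =
      ENNReal.ofReal (∑ k, (⟪w k, u k⟫_ℂ).re) := by
  rw [ContinuousLinearMap.nonneg_iff_isPositive] at h
  have hs : HasSum (fun i => (⟪onb H i, (∑ k, InnerProductSpace.rankOne ℂ (u k) (w k))
      (onb H i)⟫_ℂ).re) (∑ k, (⟪w k, u k⟫_ℂ).re) := by
    have := hasSum_sum (s := Finset.univ) fun k _ =>
      Complex.reCLM.hasSum ((onb H).hasSum_inner_mul_inner (w k) (u k))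
    refine HasSum.congr_fun this fun i => ?_
    simp only [sum_apply, InnerProductSpace.rankOne_apply, inner_sum, inner_smul_right,
      Complex.reCLM_apply, Complex.re_sum]
  rw [trace, ← hs.tsum_eq, ENNReal.ofReal_tsum_of_nonneg _ hs.summable]
  exact fun i => h.re_inner_nonneg_right _

theorem trace_eigenSum (hf : Orthonormal ℂ f) (hμ : ∀ k, 0 ≤ μ k) :
    trace (eigenSum μ f) = ENNReal.ofReal (∑ k, μ k) := by
  classical
  have h0 := eigenSum_nonneg (f := f) hμ
  have h : eigenSum μ f = ∑ k, InnerProductSpace.rankOne ℂ ((μ k : ℂ) • f k) (f k) := by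
    simp [eigenSum]
  rw [h] at h0 ⊢
  rw [trace_sum_rankOne _ _ h0]
  simp [hf.1]

theorem trace_eigenSum_conj (hf : Orthonormal ℂ f) {S : H →L[ℂ] H} (hS : 0 ≤ S)
    (hμ : ∀ k, 0 ≤ μ k) :
    trace (eigenSum μ f * S * eigenSum μ f) =
      ENNReal.ofReal (∑ k, μ k ^ 2 * (⟪f k, S (f k)⟫_ℂ).re) := by
  classical
  have hsa : IsSelfAdjoint (eigenSum μ f) := IsSelfAdjoint.of_nonneg (eigenSum_nonneg hμ)
  have h0 : 0 ≤ eigenSum μ f * S * eigenSum μ f := by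
    simpa [hsa.star_eq] using star_left_conjugate_nonneg hS (eigenSum μ f)
  have h : eigenSum μ f * S * eigenSum μ f =
      ∑ k, InnerProductSpace.rankOne ℂ ((μ k : ℂ) • eigenSum μ f (S (f k))) (f k) := by
    ext v
    simp only [mul_apply_eq_comp, eigenSum_apply v, map_sum, map_smul, sum_apply]
    exact Finset.sum_congr rfl fun k _ => rfl
  rw [h] at h0 ⊢
  rw [trace_sum_rankOne _ _ h0]
  congr 1
  refine Finset.sum_congr rfl fun k _ => ?_
  rw [inner_smul_right, ← ContinuousLinearMap.adjoint_inner_left,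
    ← ContinuousLinearMap.star_eq_adjoint, hsa.star_eq, eigenSum_apply_self hf, inner_smul_left,
    Complex.conj_ofReal, Complex.re_ofReal_mul, Complex.re_ofReal_mul]
  ring

/-- With T = X² and X self-adjoint, ⟨v, Tv⟩ = ‖Xv‖². Expanding ‖X fₖ‖² in the fixed Hilbert basis b
and exchanging the sums leaves, for each i, Bessel's inequality for X bᵢ and the family f. -/
theorem sum_inner_le_trace (hf : Orthonormal ℂ f) {T : H →L[ℂ] H} (hT : 0 ≤ T) :
    ENNReal.ofReal (∑ k, (⟪f k, T (f k)⟫_ℂ).re) ≤ trace T := by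
  obtain ⟨X, hXs, hX⟩ : ∃ X : H →L[ℂ] H, IsSelfAdjoint X ∧ X * X = T :=
    ⟨CFC.sqrt T, IsSelfAdjoint.of_nonneg (CFC.sqrt_nonneg T), CFC.sqrt_mul_sqrt_self T hT⟩
  have hsymm : ∀ u w, ⟪u, X w⟫_ℂ = ⟪X u, w⟫_ℂ := fun u w => by
    rw [← ContinuousLinearMap.adjoint_inner_left, ← ContinuousLinearMap.star_eq_adjoint,
      hXs.star_eq]
  have hn : ∀ v, (⟪v, T v⟫_ℂ).re = ‖X v‖ ^ 2 := fun v => by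
    rw [← hX, mul_apply_eq_comp, hsymm]
    exact inner_self_eq_norm_sq (𝕜 := ℂ) _
  have hpars : ∀ v, ENNReal.ofReal (‖X v‖ ^ 2) =
      ∑' i, ENNReal.ofReal (‖⟪v, X (onb H i)⟫_ℂ‖ ^ 2) := fun v => by
    have hs := Complex.reCLM.hasSum ((onb H).hasSum_inner_mul_inner (X v) (X v))
    have hr : ∀ i, Complex.reCLM (⟪X v, onb H i⟫_ℂ * ⟪onb H i, X v⟫_ℂ) =
        ‖⟪v, X (onb H i)⟫_ℂ‖ ^ 2 := fun i => by
      have e : ⟪onb H i, X v⟫_ℂ = (starRingEnd ℂ) ⟪v, X (onb H i)⟫_ℂ := by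
        rw [inner_conj_symm, hsymm]
      rw [e, ← hsymm, Complex.mul_conj, Complex.reCLM_apply,
        Complex.ofReal_re, Complex.normSq_eq_norm_sq]
    have hl : Complex.reCLM ⟪X v, X v⟫_ℂ = ‖X v‖ ^ 2 := inner_self_eq_norm_sq (𝕜 := ℂ) _
    rw [hl] at hs
    have hs' : HasSum (fun i => ‖⟪v, X (onb H i)⟫_ℂ‖ ^ 2) (‖X v‖ ^ 2) :=
      HasSum.congr_fun hs fun i => (hr i).symm
    rw [← hs'.tsum_eq, ENNReal.ofReal_tsum_of_nonneg (fun _ => by positivity) hs'.summable]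
  calc ENNReal.ofReal (∑ k, (⟪f k, T (f k)⟫_ℂ).re)
      = ∑ k, ENNReal.ofReal (‖X (f k)‖ ^ 2) := by
        rw [ENNReal.ofReal_sum_of_nonneg fun k _ => by rw [hn]; positivity]
        simp_rw [hn]
    _ = ∑' i, ∑ k, ENNReal.ofReal (‖⟪f k, X (onb H i)⟫_ℂ‖ ^ 2) := by
        simp_rw [hpars]
        rw [Summable.tsum_finsetSum fun _ _ => ENNReal.summable]
    _ ≤ trace T := by
        refine ENNReal.tsum_le_tsum fun i => ?_
        rw [← ENNReal.ofReal_sum_of_nonneg fun k _ => by positivity, hn]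
        exact ENNReal.ofReal_le_ofReal (hf.sum_inner_products_le _)

end Eigen

/-! ### Operators on the register and Eve's system -/

section Register

variable {ι : Type*} [Fintype ι]
variable {H : Type*} [NormedAddCommGroup H] [InnerProductSpace ℂ H] [CompleteSpace H]

theorem bra_apply (y : ι) (x : Joint ι H) : bra y x = x y := rfl

theorem ket_eq_single [DecidableEq ι] (y : ι) (v : H) :
    (ket y v : Joint ι H) = WithLp.toLp 2 (Pi.single y v) := by
  refine ext_inner_right ℂ fun x => ?_
  rw [ket, ContinuousLinearMap.adjoint_inner_left, PiLp.inner_apply, Finset.sum_eq_single y]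
  · simp [bra_apply]
  · intro j _ hj
    simp [hj]
  · simp

theorem ket_apply [DecidableEq ι] (y y' : ι) (v : H) :
    (ket y v : Joint ι H) y' = if y' = y then v else 0 := by
  rw [ket_eq_single]
  simp [Pi.single_apply]

theorem oneTensor_apply (T : H →L[ℂ] H) (x : Joint ι H) (y : ι) :
    oneTensor T x y = T (x y) := by
  classical
  have h : ∀ z : Joint ι H, z y = bra y z := fun _ => rfl
  rw [h, oneTensor, sum_apply, map_sum, Finset.sum_eq_single y]
  · simp [block, bra_apply, ket_apply]
  · intro j _ hj
    simp [block, bra_apply, ket_apply, hj.symm]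
  · simp

theorem oneTensor_ket (T : H →L[ℂ] H) (y : ι) (v : H) :
    oneTensor T (ket y v : Joint ι H) = ket y (T v) := by
  classical
  ext y'
  rw [oneTensor_apply, ket_apply, ket_apply]
  split_ifs <;> simp

theorem inner_ket_left (y : ι) (v : H) (x : Joint ι H) : ⟪ket y v, x⟫_ℂ = ⟪v, x y⟫_ℂ := by
  rw [ket, ContinuousLinearMap.adjoint_inner_left, bra_apply]

theorem inner_ket_ket [DecidableEq ι] (y y' : ι) (v w : H) :
    ⟪(ket y v : Joint ι H), ket y' w⟫_ℂ = if y = y' then ⟪v, w⟫_ℂ else 0 := by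
  rw [inner_ket_left, ket_apply]
  split_ifs <;> simp

theorem block_nonneg {T : H →L[ℂ] H} (hT : 0 ≤ T) (y : ι) : 0 ≤ block y T := by
  rw [ContinuousLinearMap.nonneg_iff_isPositive] at *
  exact hT.adjoint_conj (bra y)

theorem oneTensor_nonneg {T : H →L[ℂ] H} (hT : 0 ≤ T) : 0 ≤ oneTensor (ι := ι) T :=
  Finset.sum_nonneg fun y _ => block_nonneg hT y

/-- `T ↦ 1 ⊗ T` as a homomorphism of star algebras. -/
def oneTensorHom (ι : Type*) [Fintype ι] (H : Type*) [NormedAddCommGroup H]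
    [InnerProductSpace ℂ H] [CompleteSpace H] :
    (H →L[ℂ] H) →⋆ₐ[ℂ] (Joint ι H →L[ℂ] Joint ι H) where
  toFun := oneTensor
  map_one' := by ext x y; simp [oneTensor_apply]
  map_mul' S T := by ext x y; simp [oneTensor_apply]
  map_zero' := by ext x y; simp [oneTensor_apply]
  map_add' S T := by ext x y; simp [oneTensor_apply]
  commutes' r := by ext x y; simp [oneTensor_apply, Algebra.algebraMap_eq_smul_one]
  map_star' T := by
    ext1 x
    refine ext_inner_left ℂ fun z => ?_
    change _ = ⟪z, ContinuousLinearMap.adjoint (oneTensor T) x⟫_ℂ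
    rw [ContinuousLinearMap.adjoint_inner_right, PiLp.inner_apply, PiLp.inner_apply]
    simp [oneTensor_apply, ContinuousLinearMap.star_eq_adjoint,
      ContinuousLinearMap.adjoint_inner_right]

theorem oneTensorHom_apply (T : H →L[ℂ] H) : oneTensorHom ι H T = oneTensor T := rfl

theorem continuous_oneTensorHom : Continuous (oneTensorHom ι H) := by
  change Continuous fun T : H →L[ℂ] H => ∑ y : ι, ket y ∘L T ∘L bra y
  fun_prop

theorem oneTensor_add_smul_one (T : H →L[ℂ] H) (c : ℂ) :
    oneTensor (ι := ι) T + c • 1 = oneTensor (T + c • 1) := by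
  rw [← oneTensorHom_apply, ← oneTensorHom_apply, map_add, map_smul, map_one]

/-- Continuous star homomorphisms commute with the continuous functional calculus. -/
theorem rpow_oneTensor {T : H →L[ℂ] H} (hT : 0 ≤ T) {p : ℝ} (hp : 0 ≤ p ∨ IsUnit T) :
    CFC.rpow (oneTensor (ι := ι) T) p = oneTensor (CFC.rpow T p) := by
  rw [CFC.rpow_eq_pow, CFC.rpow_eq_pow, CFC.rpow_eq_cfc_real hT,
    CFC.rpow_eq_cfc_real (oneTensor_nonneg hT), ← oneTensorHom_apply, ← oneTensorHom_apply]
  exact (StarAlgHom.map_cfc (oneTensorHom ι H) (fun x : ℝ => x ^ p) T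
    (continuousOn_rpow_spectrum hp) continuous_oneTensorHom (IsSelfAdjoint.of_nonneg hT)
    (IsSelfAdjoint.of_nonneg (oneTensor_nonneg hT))).symm

variable {κ : Type*} [Fintype κ]

theorem orthonormal_ket {f : ι → κ → H} (hf : ∀ y, Orthonormal ℂ (f y)) :
    Orthonormal ℂ fun yk : ι × κ => (ket yk.1 (f yk.1 yk.2) : Joint ι H) := by
  classical
  rw [orthonormal_iff_ite]
  rintro ⟨y, k⟩ ⟨y', k'⟩
  rw [inner_ket_ket]
  by_cases hy : y = y'
  · subst hy
    simp only [if_true, orthonormal_iff_ite.1 (hf y), Prod.mk.injEq, true_and]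
  · simp [hy]

theorem sum_block_eigenSum (μ : ι → κ → ℝ) (f : ι → κ → H) :
    ∑ y, block y (eigenSum (μ y) (f y)) =
      eigenSum (fun yk : ι × κ => μ yk.1 yk.2)
        (fun yk : ι × κ => (ket yk.1 (f yk.1 yk.2) : Joint ι H)) := by
  ext1 x
  rw [eigenSum_apply, Fintype.sum_prod_type, sum_apply]
  refine Finset.sum_congr rfl fun y _ => ?_
  simp only [block, ContinuousLinearMap.comp_apply, eigenSum_apply, map_sum, map_smul,
    inner_ket_left, bra_apply]

theorem oneTensor_mul_block_mul (S T : H →L[ℂ] H) (y : ι) :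
    oneTensor S * block y T * oneTensor S = block y (S * T * S) := by
  ext1 x
  simp only [mul_apply_eq_comp, block, ContinuousLinearMap.comp_apply, oneTensor_ket, bra_apply,
    oneTensor_apply]

end Register

/-! ### Real symmetric 2×2 blocks: spectrum and traces of powers -/

section Qubit

variable {H : Type*} [NormedAddCommGroup H] [InnerProductSpace ℂ H] [CompleteSpace H]

/-- The operator with the real symmetric matrix `!![d₀, x; x, d₁]` in the basis `e`. -/
def symOp (e : Fin 2 → H) (d₀ d₁ x : ℝ) : H →L[ℂ] H :=
  (d₀ : ℂ) • InnerProductSpace.rankOne ℂ (e 0) (e 0) +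
    (d₁ : ℂ) • InnerProductSpace.rankOne ℂ (e 1) (e 1) +
    (x : ℂ) • (InnerProductSpace.rankOne ℂ (e 0) (e 1) + InnerProductSpace.rankOne ℂ (e 1) (e 0))

/-- The basis `e` rotated by the angle with cosine `c` and sine `s`. -/
def rotBasis (e : Fin 2 → H) (c s : ℝ) : Fin 2 → H :=
  ![(c : ℂ) • e 0 + (s : ℂ) • e 1, (-s : ℂ) • e 0 + (c : ℂ) • e 1]

variable {e : Fin 2 → H}

theorem symOp_apply (d₀ d₁ x : ℝ) (v : H) :
    symOp e d₀ d₁ x v = (d₀ : ℂ) • ⟪e 0, v⟫_ℂ • e 0 + (d₁ : ℂ) • ⟪e 1, v⟫_ℂ • e 1 +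
      (x : ℂ) • (⟪e 1, v⟫_ℂ • e 0 + ⟪e 0, v⟫_ℂ • e 1) := rfl

theorem symOp_apply_zero (he : Orthonormal ℂ e) (d₀ d₁ x : ℝ) :
    symOp e d₀ d₁ x (e 0) = (d₀ : ℂ) • e 0 + (x : ℂ) • e 1 := by
  simp [symOp_apply, he.1, he.2 (show (1 : Fin 2) ≠ 0 by decide)]

theorem symOp_apply_one (he : Orthonormal ℂ e) (d₀ d₁ x : ℝ) :
    symOp e d₀ d₁ x (e 1) = (d₁ : ℂ) • e 1 + (x : ℂ) • e 0 := by
  simp [symOp_apply, he.1, he.2 (show (0 : Fin 2) ≠ 1 by decide)]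

theorem orthonormal_rotBasis (he : Orthonormal ℂ e) {c s : ℝ} (h : c ^ 2 + s ^ 2 = 1) :
    Orthonormal ℂ (rotBasis e c s) := by
  have h' : (c : ℂ) ^ 2 + (s : ℂ) ^ 2 = 1 := by exact_mod_cast h
  have h01 : ⟪e 0, e 1⟫_ℂ = 0 := he.2 (by decide)
  have h10 : ⟪e 1, e 0⟫_ℂ = 0 := he.2 (by decide)
  have h00 : ⟪e 0, e 0⟫_ℂ = 1 := by simp [he.1]
  have h11 : ⟪e 1, e 1⟫_ℂ = 1 := by simp [he.1]
  rw [orthonormal_iff_ite]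
  intro i j
  fin_cases i <;> fin_cases j <;>
    simp only [rotBasis, Fin.zero_eta, Fin.mk_one, Fin.isValue, Matrix.cons_val_zero,
      Matrix.cons_val_one, inner_add_left, inner_add_right, inner_smul_left, inner_smul_right,
      h00, h01, h10, h11, map_neg, Complex.conj_ofReal, zero_ne_one, one_ne_zero, if_true, if_false]
  · linear_combination h'
  · ring
  · ring
  · linear_combination h'

theorem symOp_eq_eigenSum {d₀ d₁ x l₀ l₁ c s : ℝ} (h₀ : d₀ = l₀ * c ^ 2 + l₁ * s ^ 2)
    (h₁ : d₁ = l₀ * s ^ 2 + l₁ * c ^ 2) (hx : x = (l₀ - l₁) * (c * s)) :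
    symOp e d₀ d₁ x = eigenSum ![l₀, l₁] (rotBasis e c s) := by
  ext v
  rw [symOp_apply, eigenSum_apply, Fin.sum_univ_two, h₀, h₁, hx]
  simp only [rotBasis, Matrix.cons_val_zero, Matrix.cons_val_one, inner_add_left, inner_smul_left,
    Complex.conj_ofReal, map_neg]
  push_cast
  module

/-- The traceless part of the matrix is read as the complex number w = (d₀ - d₁)/2 + ix. Half of its
argument is the diagonalizing angle, by the double-angle formulas. -/
theorem exists_rotation (d₀ d₁ x : ℝ) : ∃ c s : ℝ, c ^ 2 + s ^ 2 = 1 ∧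
    (d₀ - d₁) / 2 = √(((d₀ - d₁) / 2) ^ 2 + x ^ 2) * (c ^ 2 - s ^ 2) ∧
    x = √(((d₀ - d₁) / 2) ^ 2 + x ^ 2) * (2 * (c * s)) := by
  set w : ℂ := ⟨(d₀ - d₁) / 2, x⟩ with hw
  have hn : √(((d₀ - d₁) / 2) ^ 2 + x ^ 2) = ‖w‖ := by
    rw [Complex.norm_def, Complex.normSq_mk, sq, sq]
  have hc := Real.cos_two_mul (w.arg / 2)
  have hs := Real.sin_two_mul (w.arg / 2)
  have h1 := Real.cos_sq_add_sin_sq (w.arg / 2)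
  rw [mul_div_cancel₀ _ (two_ne_zero)] at hc hs
  refine ⟨Real.cos (w.arg / 2), Real.sin (w.arg / 2), h1, ?_, ?_⟩
  · have := Complex.norm_mul_cos_arg w
    rw [hn, show (d₀ - d₁) / 2 = w.re from rfl, ← this, hc]
    linear_combination ‖w‖ * h1
  · have := Complex.norm_mul_sin_arg w
    rw [hn, show x = w.im from rfl, ← this, hs]
    ring

/-- The sign `(-1) ^ y`. -/
def sign (y : Fin 2) : ℝ := (-1) ^ (y : ℕ)

/-- The classical-quantum operator `∑ y, |y⟩⟨y| ⊗ symOp e d₀ d₁ ((-1) ^ y x)`. -/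
def cqOp (e : Fin 2 → H) (d₀ d₁ x : ℝ) : Joint (Fin 2) H →L[ℂ] Joint (Fin 2) H :=
  ∑ y : Fin 2, block y (symOp e d₀ d₁ (sign y * x))

theorem sign_sq (y : Fin 2) : sign y ^ 2 = 1 := by
  fin_cases y <;> simp [sign]

/-- The eigenvectors of `cqOp`. -/
def cqBasis (e : Fin 2 → H) (c s : ℝ) (yk : Fin 2 × Fin 2) : Joint (Fin 2) H :=
  ket yk.1 (rotBasis e c (sign yk.1 * s) yk.2)

theorem orthonormal_cqBasis (he : Orthonormal ℂ e) {c s : ℝ} (h : c ^ 2 + s ^ 2 = 1) :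
    Orthonormal ℂ (cqBasis e c s) :=
  orthonormal_ket (f := fun y => rotBasis e c (sign y * s)) fun y =>
    orthonormal_rotBasis he (by rw [mul_pow, sign_sq, one_mul, h])

/-- Flipping the sign of the off-diagonal entry is the same as reversing the rotation, s ↦ -s. The
eigenvalues therefore do not depend on y. -/
theorem cqOp_eq_eigenSum {d₀ d₁ x l₀ l₁ c s : ℝ} (h₀ : d₀ = l₀ * c ^ 2 + l₁ * s ^ 2)
    (h₁ : d₁ = l₀ * s ^ 2 + l₁ * c ^ 2) (hx : x = (l₀ - l₁) * (c * s)) :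
    cqOp e d₀ d₁ x = eigenSum (fun yk : Fin 2 × Fin 2 => ![l₀, l₁] yk.2) (cqBasis e c s) := by
  have h : ∀ y, symOp e d₀ d₁ (sign y * x) =
      eigenSum ![l₀, l₁] (rotBasis e c (sign y * s)) := fun y => by
    apply symOp_eq_eigenSum
    · rw [mul_pow, sign_sq, one_mul, h₀]
    · rw [mul_pow, sign_sq, one_mul, h₁]
    · rw [hx]; ring
  simp_rw [cqOp, h]
  exact sum_block_eigenSum (fun _ => ![l₀, l₁]) fun y => rotBasis e c (sign y * s)

/-- The condition x² ≤ d₀d₁ is nonnegativity of the determinant; the conclusion is nonnegativity of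
the smaller eigenvalue. -/
theorem sqrt_le_half_add {d₀ d₁ x : ℝ} (hd₀ : 0 ≤ d₀) (hd₁ : 0 ≤ d₁) (hx : x ^ 2 ≤ d₀ * d₁) :
    √(((d₀ - d₁) / 2) ^ 2 + x ^ 2) ≤ (d₀ + d₁) / 2 := by
  rw [Real.sqrt_le_left (by positivity)]
  linarith

theorem trace_rpow_cqOp (he : Orthonormal ℂ e) {d₀ d₁ x R p : ℝ} (hd₀ : 0 ≤ d₀) (hd₁ : 0 ≤ d₁)
    (hx : x ^ 2 ≤ d₀ * d₁) (hR : R = √(((d₀ - d₁) / 2) ^ 2 + x ^ 2)) (hp : 0 < p) :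
    trace (CFC.rpow (cqOp e d₀ d₁ x) p) =
      ENNReal.ofReal (2 * (((d₀ + d₁) / 2 - R) ^ p + ((d₀ + d₁) / 2 + R) ^ p)) := by
  obtain ⟨c, s, hcs, hz, hxx⟩ := exists_rotation d₀ d₁ x
  have hle := sqrt_le_half_add hd₀ hd₁ hx
  rw [← hR] at hz hxx hle
  have hR0 : 0 ≤ R := hR ▸ Real.sqrt_nonneg _
  have hμ : ∀ yk : Fin 2 × Fin 2, 0 ≤ ![(d₀ + d₁) / 2 + R, (d₀ + d₁) / 2 - R] yk.2 := by
    rintro ⟨y, k⟩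
    fin_cases k
    · simp; linarith
    · simpa using hle
  have hb := orthonormal_cqBasis he hcs
  rw [cqOp_eq_eigenSum (l₀ := (d₀ + d₁) / 2 + R) (l₁ := (d₀ + d₁) / 2 - R) (c := c) (s := s),
    rpow_eigenSum hb hμ hp, trace_eigenSum hb fun yk => Real.rpow_nonneg (hμ yk) _]
  · congr 1
    simp only [Fintype.sum_prod_type, Fin.sum_univ_two, Matrix.cons_val_zero, Matrix.cons_val_one]
    ring
  · linear_combination hz - (d₀ + d₁) / 2 * hcs
  · linear_combination -hz - (d₀ + d₁) / 2 * hcs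
  · linear_combination hxx

/-- In the eigenbasis the cross terms ⟨e₀,S e₁⟩ and ⟨e₁,S e₀⟩ carry the factor cs with the sign of
y, and cancel in the sum over y. What remains are the weights 2c² and 2s², that is, 1 ± cos of the
doubled angle, whose cosine is (d₀ - d₁)/(2R). -/
theorem trace_rpow_mul_oneTensor_mul_rpow_cqOp (he : Orthonormal ℂ e) {d₀ d₁ x R a : ℝ}
    (hd₀ : 0 ≤ d₀) (hd₁ : 0 ≤ d₁) (hx : x ^ 2 ≤ d₀ * d₁)
    (hR : R = √(((d₀ - d₁) / 2) ^ 2 + x ^ 2)) (hR0 : 0 < R) (ha : 0 < a)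
    {S : H →L[ℂ] H} (hS : 0 ≤ S) :
    trace (CFC.rpow (cqOp e d₀ d₁ x) (a / 2) * oneTensor S * CFC.rpow (cqOp e d₀ d₁ x) (a / 2)) =
      ENNReal.ofReal
        ((((d₀ + d₁) / 2 + R) ^ a * (1 + (d₀ - d₁) / 2 / R)
            + ((d₀ + d₁) / 2 - R) ^ a * (1 - (d₀ - d₁) / 2 / R)) * (⟪e 0, S (e 0)⟫_ℂ).re
          + (((d₀ + d₁) / 2 + R) ^ a * (1 - (d₀ - d₁) / 2 / R)
            + ((d₀ + d₁) / 2 - R) ^ a * (1 + (d₀ - d₁) / 2 / R)) * (⟪e 1, S (e 1)⟫_ℂ).re) := by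
  obtain ⟨c, s, hcs, hz, hxx⟩ := exists_rotation d₀ d₁ x
  have hle := sqrt_le_half_add hd₀ hd₁ hx
  rw [← hR] at hz hxx hle
  have hμ : ∀ yk : Fin 2 × Fin 2, 0 ≤ ![(d₀ + d₁) / 2 + R, (d₀ + d₁) / 2 - R] yk.2 := by
    rintro ⟨y, k⟩
    fin_cases k
    · simp; linarith
    · simpa using hle
  have hb := orthonormal_cqBasis he hcs
  rw [cqOp_eq_eigenSum (l₀ := (d₀ + d₁) / 2 + R) (l₁ := (d₀ + d₁) / 2 - R) (c := c) (s := s),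
    rpow_eigenSum hb hμ (half_pos ha),
    trace_eigenSum_conj hb (oneTensor_nonneg hS) fun yk => Real.rpow_nonneg (hμ yk) _]
  · congr 1
    have hsq : ∀ yk : Fin 2 × Fin 2, (![(d₀ + d₁) / 2 + R, (d₀ + d₁) / 2 - R] yk.2 ^ (a / 2)) ^ 2 =
        ![(d₀ + d₁) / 2 + R, (d₀ + d₁) / 2 - R] yk.2 ^ a := fun yk => by
      rw [← Real.rpow_mul_natCast (hμ yk)]
      norm_num
    have hq : (d₀ - d₁) / 2 / R = c ^ 2 - s ^ 2 := by
      rw [div_eq_iff hR0.ne', hz, mul_comm]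
    have h1 : 1 + (c ^ 2 - s ^ 2) = 2 * c ^ 2 := by linear_combination -hcs
    have h2 : 1 - (c ^ 2 - s ^ 2) = 2 * s ^ 2 := by linear_combination -hcs
    simp_rw [hsq]
    rw [hq, h1, h2]
    simp only [Fintype.sum_prod_type, Fin.sum_univ_two, cqBasis, oneTensor_ket, inner_ket_ket,
      if_true, rotBasis, sign, Matrix.cons_val_zero, Matrix.cons_val_one, map_add, map_smul,
      inner_add_left, inner_add_right, inner_smul_left, inner_smul_right, Complex.add_re,
      Complex.conj_ofReal, ← Complex.ofReal_neg, Complex.re_ofReal_mul]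
    simp
    ring
  · linear_combination hz - (d₀ + d₁) / 2 * hcs
  · linear_combination -hz - (d₀ + d₁) / 2 * hcs
  · linear_combination hxx

end Qubit

/-! ### Petz divergences and the optimization over σ -/

section Renyi

theorem neg_renyi_ofReal (a : ℝ) {q : ℝ} (hq : 0 < q) :
    -(((1 / (a - 1) : ℝ) : EReal) * log2 (ENNReal.ofReal q)) =
      ((1 / (1 - a) * Real.logb 2 q : ℝ) : EReal) := by
  rw [log2, ENNReal.log_ofReal_of_pos hq, ← EReal.coe_mul, ← EReal.coe_mul, ← EReal.coe_neg,
    ← neg_sub a 1, Real.logb, div_neg]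
  congr 1
  ring

theorem log2_mono : Monotone log2 := fun x y h => by
  have h0 : (0 : EReal) ≤ ((1 / Real.log 2 : ℝ) : EReal) := by
    exact_mod_cast (one_div_pos.2 (Real.log_pos one_lt_two)).le
  exact mul_le_mul_of_nonneg_left (ENNReal.log_monotone h) h0

theorem neg_renyi_mono_of_lt_one {a : ℝ} (ha : a < 1) {x y : ℝ≥0∞} (h : x ≤ y) :
    -(((1 / (a - 1) : ℝ) : EReal) * log2 x) ≤ -(((1 / (a - 1) : ℝ) : EReal) * log2 y) := by
  rw [← EReal.neg_mul, ← EReal.neg_mul, ← EReal.coe_neg]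
  refine mul_le_mul_of_nonneg_left (log2_mono h) ?_
  have : 1 / (a - 1) < 0 := one_div_neg.2 (by linarith)
  exact_mod_cast (neg_pos.2 this).le

theorem neg_renyi_anti_of_one_lt {a : ℝ} (ha : 1 < a) {x y : ℝ≥0∞} (h : x ≤ y) :
    -(((1 / (a - 1) : ℝ) : EReal) * log2 y) ≤ -(((1 / (a - 1) : ℝ) : EReal) * log2 x) := by
  rw [EReal.neg_le_neg_iff]
  refine mul_le_mul_of_nonneg_left (log2_mono h) ?_
  exact_mod_cast (one_div_pos.2 (sub_pos.2 ha)).le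

/-- Concavity of the power: Bernoulli's inequality at u/t, rescaled by t ^ p. -/
theorem rpow_le_tangent {p t u : ℝ} (hp0 : 0 ≤ p) (hp1 : p ≤ 1) (ht : 0 < t) (hu : 0 ≤ u) :
    u ^ p ≤ t ^ p + p * t ^ (p - 1) * (u - t) := by
  have h := rpow_one_add_le_one_add_mul_self (s := u / t - 1)
    (by have := div_nonneg hu ht.le; linarith) hp0 hp1
  have h1 : u ^ p = t ^ p * (1 + (u / t - 1)) ^ p := by
    rw [add_sub_cancel, ← Real.mul_rpow ht.le (div_nonneg hu ht.le), mul_div_cancel₀ _ ht.ne']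
  rw [h1, Real.rpow_sub_one ht.ne']
  calc _ ≤ t ^ p * (1 + p * (u / t - 1)) := by gcongr
    _ = _ := by field_simp

/-- Convexity of the power. Since p ≤ 0, log(u/t) ≤ u/t - 1 gives p(u/t - 1) ≤ p log(u/t), and 1 + z
≤ exp z concludes. -/
theorem tangent_le_rpow {p t u : ℝ} (hp : p ≤ 0) (ht : 0 < t) (hu : 0 < u) :
    t ^ p + p * t ^ (p - 1) * (u - t) ≤ u ^ p := by
  have hut : 0 < u / t := div_pos hu ht
  have h : 1 + p * (u / t - 1) ≤ (u / t) ^ p := by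
    rw [Real.rpow_def_of_pos hut]
    have h2 := Real.log_le_sub_one_of_pos hut
    have h3 := Real.add_one_le_exp (Real.log (u / t) * p)
    nlinarith
  have h1 : u ^ p = t ^ p * (u / t) ^ p := by
    rw [← Real.mul_rpow ht.le hut.le, mul_div_cancel₀ _ ht.ne']
  rw [h1, Real.rpow_sub_one ht.ne']
  calc _ = t ^ p * (1 + p * (u / t - 1)) := by field_simp
    _ ≤ _ := by gcongr

variable {H : Type*} [NormedAddCommGroup H] [InnerProductSpace ℂ H] [CompleteSpace H]

theorem re_inner_mono {S T : H →L[ℂ] H} (h : S ≤ T) (v : H) :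
    (⟪v, S v⟫_ℂ).re ≤ (⟪v, T v⟫_ℂ).re := by
  have := ((ContinuousLinearMap.le_def S T).1 h).re_inner_nonneg_right v
  simpa [inner_sub_right] using this

theorem re_inner_cfc_affine {T : H →L[ℂ] H} (hT : IsSelfAdjoint T) {v : H} (hv : ‖v‖ = 1)
    (A B : ℝ) : (⟪v, cfc (fun x : ℝ => A + B * x) T v⟫_ℂ).re = A + B * (⟪v, T v⟫_ℂ).re := by
  rw [cfc_const_add A (fun x => B * x) T, cfc_const_mul_id B T]
  simp only [Algebra.algebraMap_eq_smul_one, add_apply, inner_add_right, Complex.add_re]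
  simp [inner_smul_right_eq_smul, hv]

/-- The scalar tangent bound holds on the spectrum, so it passes to operators by monotonicity of the
functional calculus. The point t stays free, to be chosen independently for each vector. -/
theorem re_inner_rpow_le {T : H →L[ℂ] H} (hT : 0 ≤ T) {p t : ℝ} (hp0 : 0 ≤ p) (hp1 : p ≤ 1)
    (ht : 0 < t) {v : H} (hv : ‖v‖ = 1) :
    (⟪v, CFC.rpow T p v⟫_ℂ).re ≤ t ^ p + p * t ^ (p - 1) * ((⟪v, T v⟫_ℂ).re - t) := by
  have hsa := IsSelfAdjoint.of_nonneg hT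
  have h : CFC.rpow T p ≤
      cfc (fun x : ℝ => t ^ p - p * t ^ (p - 1) * t + p * t ^ (p - 1) * x) T := by
    rw [CFC.rpow_eq_pow, CFC.rpow_eq_cfc_real hT]
    refine cfc_mono (fun x hx => ?_) (continuousOn_rpow_spectrum (Or.inl hp0)) (by fun_prop)
    have := rpow_le_tangent hp0 hp1 ht (spectrum_nonneg_of_nonneg hT hx)
    linarith
  have := re_inner_mono h v
  rw [re_inner_cfc_affine hsa hv] at this
  linarith

theorem le_re_inner_rpow {T : H →L[ℂ] H} (hT : 0 ≤ T) (hu : IsUnit T) {p t : ℝ} (hp : p ≤ 0)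
    (ht : 0 < t) {v : H} (hv : ‖v‖ = 1) :
    t ^ p + p * t ^ (p - 1) * ((⟪v, T v⟫_ℂ).re - t) ≤ (⟪v, CFC.rpow T p v⟫_ℂ).re := by
  have hsa := IsSelfAdjoint.of_nonneg hT
  have h : cfc (fun x : ℝ => t ^ p - p * t ^ (p - 1) * t + p * t ^ (p - 1) * x) T ≤
      CFC.rpow T p := by
    rw [CFC.rpow_eq_pow, CFC.rpow_eq_cfc_real hT]
    refine cfc_mono (fun x hx => ?_) (by fun_prop) (continuousOn_rpow_spectrum (Or.inr hu))
    have hx0 : x ≠ 0 := fun h0 => spectrum.zero_notMem ℝ hu (h0 ▸ hx)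
    have := tangent_le_rpow hp ht ((spectrum_nonneg_of_nonneg hT hx).lt_of_ne' hx0)
    linarith
  have := re_inner_mono h v
  rw [re_inner_cfc_affine hsa hv] at this
  linarith

theorem rpow_operator_nonneg (T : H →L[ℂ] H) (p : ℝ) : 0 ≤ CFC.rpow T p :=
  CFC.rpow_nonneg (a := T) (y := p)

variable {ι : Type*} [Fintype ι] {ρ : Joint ι H →L[ℂ] Joint ι H} {a A₀ A₁ : ℝ} {e : Fin 2 → H}

/-- The hypothesis `hρ` is all that the Petz quantities use of ρ: two weights A₀, A₁ on the diagonal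
entries of S. -/
theorem petzQ_oneTensor_of_lt_one
    (hρ : ∀ S : H →L[ℂ] H, 0 ≤ S →
      trace (CFC.rpow ρ (a / 2) * oneTensor S * CFC.rpow ρ (a / 2)) =
        ENNReal.ofReal (A₀ * (⟪e 0, S (e 0)⟫_ℂ).re + A₁ * (⟪e 1, S (e 1)⟫_ℂ).re))
    (ha : a < 1) {σ : H →L[ℂ] H} (hσ : 0 ≤ σ) :
    petzQ a ρ (oneTensor σ) =
      ENNReal.ofReal (A₀ * (⟪e 0, CFC.rpow σ (1 - a) (e 0)⟫_ℂ).re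
        + A₁ * (⟪e 1, CFC.rpow σ (1 - a) (e 1)⟫_ℂ).re) := by
  rw [petzQ, if_pos ha, rpow_oneTensor hσ (Or.inl (by linarith)), hρ _ (rpow_operator_nonneg _ _)]

theorem petzQ_oneTensor_of_one_lt
    (hρ : ∀ S : H →L[ℂ] H, 0 ≤ S →
      trace (CFC.rpow ρ (a / 2) * oneTensor S * CFC.rpow ρ (a / 2)) =
        ENNReal.ofReal (A₀ * (⟪e 0, S (e 0)⟫_ℂ).re + A₁ * (⟪e 1, S (e 1)⟫_ℂ).re))
    (ha : 1 < a) {σ : H →L[ℂ] H} (hσ : 0 ≤ σ) :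
    petzQ a ρ (oneTensor σ) =
      Filter.liminf (fun ε : ℝ => ENNReal.ofReal
        (A₀ * (⟪e 0, CFC.rpow (σ + (ε : ℂ) • 1) (1 - a) (e 0)⟫_ℂ).re
          + A₁ * (⟪e 1, CFC.rpow (σ + (ε : ℂ) • 1) (1 - a) (e 1)⟫_ℂ).re)) (𝓝[>] 0) := by
  rw [petzQ, if_neg ha.not_gt]
  refine Filter.liminf_congr ?_
  filter_upwards [self_mem_nhdsWithin] with ε hε
  rw [oneTensor_add_smul_one, rpow_oneTensor (add_nonneg hσ (smul_one_nonneg (le_of_lt hε)))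
    (Or.inr (isUnit_add_smul_one hσ hε)), hρ _ (rpow_operator_nonneg _ _)]

theorem add_smul_one_apply {σ : H →L[ℂ] H} {s : ℝ} {v : H} (hv : σ v = (s : ℂ) • v) (ε : ℝ) :
    (σ + (ε : ℂ) • 1) v = ((s + ε : ℝ) : ℂ) • v := by
  rw [Complex.ofReal_add, add_smul, ← hv]
  simp

/-- For a > 1 the limit ε ↓ 0 is taken in (sᵢ + ε) ^ (1 - a), which is continuous at ε = 0 because
sᵢ > 0. -/
theorem petzQ_oneTensor_of_eigenvectors (he : Orthonormal ℂ e)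
    (hρ : ∀ S : H →L[ℂ] H, 0 ≤ S →
      trace (CFC.rpow ρ (a / 2) * oneTensor S * CFC.rpow ρ (a / 2)) =
        ENNReal.ofReal (A₀ * (⟪e 0, S (e 0)⟫_ℂ).re + A₁ * (⟪e 1, S (e 1)⟫_ℂ).re))
    (ha : a ≠ 1) {σ : H →L[ℂ] H} (hσ : 0 ≤ σ) {s₀ s₁ : ℝ} (hs₀ : 0 < s₀) (hs₁ : 0 < s₁)
    (h₀ : σ (e 0) = (s₀ : ℂ) • e 0) (h₁ : σ (e 1) = (s₁ : ℂ) • e 1) :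
    petzQ a ρ (oneTensor σ) = ENNReal.ofReal (A₀ * s₀ ^ (1 - a) + A₁ * s₁ ^ (1 - a)) := by
  have hin : ∀ (r : ℝ) (i : Fin 2), (⟪e i, (r : ℂ) • e i⟫_ℂ).re = r := fun r i => by
    rw [inner_smul_right, inner_self_eq_norm_sq_to_K, he.1]
    simp
  rcases lt_or_gt_of_ne ha with ha | ha
  · have hp : 0 ≤ 1 - a ∨ IsUnit σ := Or.inl (by linarith)
    rw [petzQ_oneTensor_of_lt_one hρ ha hσ, rpow_apply_of_eigenvector hσ hp h₀,
      rpow_apply_of_eigenvector hσ hp h₁, hin, hin]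
  · rw [petzQ_oneTensor_of_one_lt hρ ha hσ]
    have hev : (fun ε : ℝ => ENNReal.ofReal
        (A₀ * (⟪e 0, CFC.rpow (σ + (ε : ℂ) • 1) (1 - a) (e 0)⟫_ℂ).re
          + A₁ * (⟪e 1, CFC.rpow (σ + (ε : ℂ) • 1) (1 - a) (e 1)⟫_ℂ).re)) =ᶠ[𝓝[>] 0]
        fun ε : ℝ => ENNReal.ofReal (A₀ * (s₀ + ε) ^ (1 - a) + A₁ * (s₁ + ε) ^ (1 - a)) := by
      filter_upwards [self_mem_nhdsWithin] with ε hε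
      have hpos : 0 ≤ σ + (ε : ℂ) • 1 := add_nonneg hσ (smul_one_nonneg (le_of_lt hε))
      have hp : 0 ≤ 1 - a ∨ IsUnit (σ + (ε : ℂ) • 1) := Or.inr (isUnit_add_smul_one hσ hε)
      rw [rpow_apply_of_eigenvector hpos hp (add_smul_one_apply h₀ ε),
        rpow_apply_of_eigenvector hpos hp (add_smul_one_apply h₁ ε), hin, hin]
    rw [Filter.liminf_congr hev]
    refine Filter.Tendsto.liminf_eq (Filter.Tendsto.mono_left ?_ nhdsWithin_le_nhds)
    refine ENNReal.tendsto_ofReal ?_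
    have hc : ∀ s : ℝ, 0 < s → Filter.Tendsto (fun ε : ℝ => (s + ε) ^ (1 - a)) (𝓝 0)
        (𝓝 (s ^ (1 - a))) := fun s hs => by
      have : ContinuousAt (fun ε : ℝ => (s + ε) ^ (1 - a)) 0 :=
        ContinuousAt.rpow_const (by fun_prop) (Or.inl (by simpa using hs.ne'))
      simpa using this.tendsto
    exact ((hc s₀ hs₀).const_mul A₀).add ((hc s₁ hs₁).const_mul A₁)

theorem sum_inner_le_one (he : Orthonormal ℂ e) {σ : H →L[ℂ] H} (hσ : IsDensity σ) :
    (⟪e 0, σ (e 0)⟫_ℂ).re + (⟪e 1, σ (e 1)⟫_ℂ).re ≤ 1 := by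
  have h := sum_inner_le_trace he (ContinuousLinearMap.nonneg_iff_isPositive σ |>.2 hσ.1)
  rw [hσ.2, Fin.sum_univ_two] at h
  simpa using h

theorem petzUp_of_weights (he : Orthonormal ℂ e)
    (hρ : ∀ S : H →L[ℂ] H, 0 ≤ S →
      trace (CFC.rpow ρ (a / 2) * oneTensor S * CFC.rpow ρ (a / 2)) =
        ENNReal.ofReal (A₀ * (⟪e 0, S (e 0)⟫_ℂ).re + A₁ * (⟪e 1, S (e 1)⟫_ℂ).re))
    (ha0 : 0 < a) (ha : a ≠ 1) (hA₀ : 0 < A₀) (hA₁ : 0 < A₁) :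
    petzUp a ρ =
      ((a / (1 - a) * Real.logb 2 (A₀ ^ (1 / a) + A₁ ^ (1 / a)) : ℝ) : EReal) := by
  set N := A₀ ^ (1 / a) + A₁ ^ (1 / a) with hN
  have hN0 : 0 < N := by positivity
  -- The stationary point of A₀t₀^(1-a) + A₁t₁^(1-a) on t₀ + t₁ = 1.
  set t₀ := A₀ ^ (1 / a) / N with ht₀
  set t₁ := A₁ ^ (1 / a) / N with ht₁
  have ht₀pos : 0 < t₀ := by positivity
  have ht₁pos : 0 < t₁ := by positivity
  have hsum : t₀ + t₁ = 1 := by rw [ht₀, ht₁, ← add_div, div_self hN0.ne']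
  have hpow : ∀ A : ℝ, 0 < A → A * (A ^ (1 / a) / N) ^ (-a) = N ^ a := fun A hA => by
    rw [Real.rpow_neg (by positivity), Real.div_rpow (by positivity) hN0.le, ← Real.rpow_mul hA.le,
      one_div_mul_cancel ha0.ne', Real.rpow_one]
    field_simp
  -- Both tangents have slope (1 - a)N^a once weighted by Aᵢ: this is the Lagrange condition.
  have hw₀ : A₀ * t₀ ^ (-a) = N ^ a := hpow A₀ hA₀
  have hw₁ : A₁ * t₁ ^ (-a) = N ^ a := hpow A₁ hA₁
  have hv₀ : A₀ * t₀ ^ (1 - a) = N ^ a * t₀ := by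
    rw [sub_eq_add_neg, add_comm, Real.rpow_add_one ht₀pos.ne', ← mul_assoc, hw₀]
  have hv₁ : A₁ * t₁ ^ (1 - a) = N ^ a * t₁ := by
    rw [sub_eq_add_neg, add_comm, Real.rpow_add_one ht₁pos.ne', ← mul_assoc, hw₁]
  have hNa : 0 < N ^ a := by positivity
  have hval : ((a / (1 - a) * Real.logb 2 N : ℝ) : EReal) =
      -(((1 / (a - 1) : ℝ) : EReal) * log2 (ENNReal.ofReal (N ^ a))) := by
    rw [neg_renyi_ofReal a hNa, Real.logb_rpow_eq_mul_logb_of_pos hN0]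
    congr 1
    ring
  have hp : (1 - a) - 1 = -a := by ring
  refine le_antisymm (iSup₂_le fun σ hσ => ?_) ?_
  · have hσ0 : 0 ≤ σ := (ContinuousLinearMap.nonneg_iff_isPositive σ).2 hσ.1
    have hle := sum_inner_le_one he hσ
    rw [petzDiv, hval]
    rcases lt_or_gt_of_ne ha with ha | ha
    · refine neg_renyi_mono_of_lt_one ha ?_
      rw [petzQ_oneTensor_of_lt_one hρ ha hσ0]
      refine ENNReal.ofReal_le_ofReal ?_
      have e0 := re_inner_rpow_le hσ0 (p := 1 - a) (by linarith) (by linarith) ht₀pos (he.1 0)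
      have e1 := re_inner_rpow_le hσ0 (p := 1 - a) (by linarith) (by linarith) ht₁pos (he.1 1)
      rw [hp] at e0 e1
      calc _ ≤ A₀ * (t₀ ^ (1 - a) + (1 - a) * t₀ ^ (-a) * ((⟪e 0, σ (e 0)⟫_ℂ).re - t₀)) +
            A₁ * (t₁ ^ (1 - a) + (1 - a) * t₁ ^ (-a) * ((⟪e 1, σ (e 1)⟫_ℂ).re - t₁)) := by
            gcongr
        _ = N ^ a + N ^ a * (1 - a) *
              ((⟪e 0, σ (e 0)⟫_ℂ).re + (⟪e 1, σ (e 1)⟫_ℂ).re - 1) := by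
            linear_combination hv₀ + hv₁ + (1 - a) * ((⟪e 0, σ (e 0)⟫_ℂ).re - t₀) * hw₀ +
              (1 - a) * ((⟪e 1, σ (e 1)⟫_ℂ).re - t₁) * hw₁ + a * N ^ a * hsum
        _ ≤ N ^ a := by
            have : 0 ≤ N ^ a * (1 - a) := mul_nonneg hNa.le (by linarith)
            nlinarith
    · refine neg_renyi_anti_of_one_lt ha ?_
      rw [petzQ_oneTensor_of_one_lt hρ ha hσ0]
      -- Passing from σ to σ + ε raises both expectation values by ε. The resulting error 2ε
      -- disappears in the limit.
      have hlim : Filter.Tendsto (fun ε : ℝ => ENNReal.ofReal (N ^ a + N ^ a * (1 - a) * (2 * ε)))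
          (𝓝[>] 0) (𝓝 (ENNReal.ofReal (N ^ a))) := by
        refine ENNReal.tendsto_ofReal (Filter.Tendsto.mono_left ?_ nhdsWithin_le_nhds)
        have : Continuous fun ε : ℝ => N ^ a + N ^ a * (1 - a) * (2 * ε) := by fun_prop
        simpa using this.tendsto 0
      rw [← hlim.liminf_eq]
      refine Filter.liminf_le_liminf ?_
      filter_upwards [self_mem_nhdsWithin] with ε hε
      refine ENNReal.ofReal_le_ofReal ?_
      have hpos : 0 ≤ σ + (ε : ℂ) • 1 := add_nonneg hσ0 (smul_one_nonneg (le_of_lt hε))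
      have hu := isUnit_add_smul_one hσ0 hε
      have e0 := le_re_inner_rpow hpos hu (p := 1 - a) (by linarith) ht₀pos (he.1 0)
      have e1 := le_re_inner_rpow hpos hu (p := 1 - a) (by linarith) ht₁pos (he.1 1)
      have hin : ∀ i : Fin 2, (⟪e i, (σ + (ε : ℂ) • 1) (e i)⟫_ℂ).re =
          (⟪e i, σ (e i)⟫_ℂ).re + ε := fun i => by
        have h1 : ((ε : ℂ) • (1 : H →L[ℂ] H)) (e i) = (ε : ℂ) • e i := rfl
        rw [add_apply, inner_add_right, Complex.add_re, h1, inner_smul_right,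
          inner_self_eq_norm_sq_to_K, he.1]
        simp
      rw [hp, hin] at e0 e1
      calc N ^ a + N ^ a * (1 - a) * (2 * ε) ≤ N ^ a + N ^ a * (1 - a) *
              ((⟪e 0, σ (e 0)⟫_ℂ).re + (⟪e 1, σ (e 1)⟫_ℂ).re + 2 * ε - 1) := by
            have : 0 ≤ N ^ a * (a - 1) := mul_nonneg hNa.le (by linarith)
            nlinarith
        _ = A₀ * (t₀ ^ (1 - a) + (1 - a) * t₀ ^ (-a) * ((⟪e 0, σ (e 0)⟫_ℂ).re + ε - t₀)) +
            A₁ * (t₁ ^ (1 - a) + (1 - a) * t₁ ^ (-a) * ((⟪e 1, σ (e 1)⟫_ℂ).re + ε - t₁)) := by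
            linear_combination -hv₀ - hv₁ - (1 - a) * ((⟪e 0, σ (e 0)⟫_ℂ).re + ε - t₀) * hw₀ -
              (1 - a) * ((⟪e 1, σ (e 1)⟫_ℂ).re + ε - t₁) * hw₁ - a * N ^ a * hsum
        _ ≤ _ := by gcongr
  -- The bound is attained at the density operator diag(t₀, t₁).
  · have hμ : ∀ i, 0 ≤ ![t₀, t₁] i := fun i => by
      fin_cases i
      exacts [ht₀pos.le, ht₁pos.le]
    have hnn : 0 ≤ eigenSum ![t₀, t₁] e := eigenSum_nonneg hμ
    have hd : IsDensity (eigenSum ![t₀, t₁] e) := by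
      refine ⟨(ContinuousLinearMap.nonneg_iff_isPositive _).1 hnn, ?_⟩
      rw [trace_eigenSum he hμ]
      simp [hsum]
    refine le_of_eq_of_le ?_ (le_iSup₂_of_le (eigenSum ![t₀, t₁] e) hd le_rfl)
    rw [petzDiv, petzQ_oneTensor_of_eigenvectors he hρ ha hnn ht₀pos ht₁pos
      (eigenSum_apply_self he 0) (eigenSum_apply_self he 1), hval, hv₀, hv₁, ← mul_add, hsum,
      mul_one]

end Renyi

/-! ### Sandwiched divergences against a diagonal operator -/

section Sandwiched

variable {H : Type*} [NormedAddCommGroup H] [InnerProductSpace ℂ H] [CompleteSpace H]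
variable {e : Fin 2 → H}

theorem mul_symOp_mul {S : H →L[ℂ] H} (hS : 0 ≤ S) {q₀ q₁ : ℝ}
    (h₀ : S (e 0) = (q₀ : ℂ) • e 0) (h₁ : S (e 1) = (q₁ : ℂ) • e 1) (d₀ d₁ x : ℝ) :
    S * symOp e d₀ d₁ x * S = symOp e (d₀ * q₀ ^ 2) (d₁ * q₁ ^ 2) (x * (q₀ * q₁)) := by
  have hS' := (ContinuousLinearMap.nonneg_iff_isPositive S).1 hS
  ext v
  have i0 : ⟪e 0, S v⟫_ℂ = q₀ * ⟪e 0, v⟫_ℂ := by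
    rw [← hS'.inner_left_eq_inner_right, h₀, inner_smul_left, Complex.conj_ofReal]
  have i1 : ⟪e 1, S v⟫_ℂ = q₁ * ⟪e 1, v⟫_ℂ := by
    rw [← hS'.inner_left_eq_inner_right, h₁, inner_smul_left, Complex.conj_ofReal]
  rw [mul_apply_eq_comp, mul_apply_eq_comp, symOp_apply, symOp_apply, i0, i1]
  simp only [map_add, map_smul, h₀, h₁]
  push_cast
  module

theorem oneTensor_mul_cqOp_mul {S : H →L[ℂ] H} (hS : 0 ≤ S) {q₀ q₁ : ℝ}
    (h₀ : S (e 0) = (q₀ : ℂ) • e 0) (h₁ : S (e 1) = (q₁ : ℂ) • e 1) (d₀ d₁ x : ℝ) :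
    oneTensor S * cqOp e d₀ d₁ x * oneTensor S =
      cqOp e (d₀ * q₀ ^ 2) (d₁ * q₁ ^ 2) (x * (q₀ * q₁)) := by
  simp_rw [cqOp, Finset.mul_sum, Finset.sum_mul, oneTensor_mul_block_mul, mul_symOp_mul hS h₀ h₁,
    mul_assoc]

/-- The trace of the `a`-th power of `cqOp e d₀ d₁ x`. -/
def cqPowTrace (a d₀ d₁ x : ℝ) : ℝ :=
  2 * (((d₀ + d₁) / 2 - √(((d₀ - d₁) / 2) ^ 2 + x ^ 2)) ^ a +
    ((d₀ + d₁) / 2 + √(((d₀ - d₁) / 2) ^ 2 + x ^ 2)) ^ a)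

theorem trace_rpow_conj_cqOp (he : Orthonormal ℂ e) {d₀ d₁ x a p s₀ s₁ : ℝ} (hd₀ : 0 ≤ d₀)
    (hd₁ : 0 ≤ d₁) (hx : x ^ 2 ≤ d₀ * d₁) (ha : 0 < a) {σ : H →L[ℂ] H} (hσ : 0 ≤ σ)
    (hp : 0 ≤ p ∨ IsUnit σ) (h₀ : σ (e 0) = (s₀ : ℂ) • e 0) (h₁ : σ (e 1) = (s₁ : ℂ) • e 1) :
    trace (CFC.rpow (CFC.rpow (oneTensor (ι := Fin 2) σ) p * cqOp e d₀ d₁ x *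
        CFC.rpow (oneTensor (ι := Fin 2) σ) p) a) =
      ENNReal.ofReal (cqPowTrace a (d₀ * (s₀ ^ p) ^ 2) (d₁ * (s₁ ^ p) ^ 2)
        (x * (s₀ ^ p * s₁ ^ p))) := by
  rw [rpow_oneTensor hσ hp, oneTensor_mul_cqOp_mul (rpow_operator_nonneg σ p)
    (rpow_apply_of_eigenvector hσ hp h₀) (rpow_apply_of_eigenvector hσ hp h₁),
    trace_rpow_cqOp he (by positivity) (by positivity) ?_ rfl ha, cqPowTrace]
  calc (x * (s₀ ^ p * s₁ ^ p)) ^ 2 = x ^ 2 * (s₀ ^ p * s₁ ^ p) ^ 2 := by ring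
    _ ≤ d₀ * d₁ * (s₀ ^ p * s₁ ^ p) ^ 2 := by gcongr
    _ = _ := by ring

theorem sandwichedQ_cqOp (he : Orthonormal ℂ e) {d₀ d₁ x a s₀ s₁ : ℝ} (hd₀ : 0 ≤ d₀)
    (hd₁ : 0 ≤ d₁) (hx : x ^ 2 ≤ d₀ * d₁) (ha0 : 0 < a) (ha : a ≠ 1) {σ : H →L[ℂ] H} (hσ : 0 ≤ σ)
    (hs₀ : 0 < s₀) (hs₁ : 0 < s₁) (h₀ : σ (e 0) = (s₀ : ℂ) • e 0)
    (h₁ : σ (e 1) = (s₁ : ℂ) • e 1) :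
    sandwichedQ a (cqOp e d₀ d₁ x) (oneTensor (ι := Fin 2) σ) =
      ENNReal.ofReal (cqPowTrace a (d₀ * (s₀ ^ ((1 - a) / (2 * a))) ^ 2)
        (d₁ * (s₁ ^ ((1 - a) / (2 * a))) ^ 2)
        (x * (s₀ ^ ((1 - a) / (2 * a)) * s₁ ^ ((1 - a) / (2 * a))))) := by
  rcases lt_or_gt_of_ne ha with ha1 | ha1
  · rw [sandwichedQ, if_pos ha1]
    have hp : 0 ≤ (1 - a) / (2 * a) := div_nonneg (by linarith) (by linarith)
    exact trace_rpow_conj_cqOp he hd₀ hd₁ hx ha0 hσ (Or.inl hp) h₀ h₁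
  · rw [sandwichedQ, if_neg ha1.not_gt]
    generalize (1 - a) / (2 * a) = p
    have hev : (fun ε : ℝ => trace (CFC.rpow (CFC.rpow (oneTensor (ι := Fin 2) σ + (ε : ℂ) • 1) p *
        cqOp e d₀ d₁ x * CFC.rpow (oneTensor (ι := Fin 2) σ + (ε : ℂ) • 1) p) a)) =ᶠ[𝓝[>] 0]
        fun ε : ℝ => ENNReal.ofReal (cqPowTrace a (d₀ * ((s₀ + ε) ^ p) ^ 2)
          (d₁ * ((s₁ + ε) ^ p) ^ 2) (x * ((s₀ + ε) ^ p * (s₁ + ε) ^ p))) := by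
      filter_upwards [self_mem_nhdsWithin] with ε hε
      rw [oneTensor_add_smul_one]
      exact trace_rpow_conj_cqOp he hd₀ hd₁ hx ha0
        (add_nonneg hσ (smul_one_nonneg (le_of_lt hε))) (Or.inr (isUnit_add_smul_one hσ hε))
        (add_smul_one_apply h₀ ε) (add_smul_one_apply h₁ ε)
    rw [Filter.liminf_congr hev]
    refine Filter.Tendsto.liminf_eq (Filter.Tendsto.mono_left ?_ nhdsWithin_le_nhds)
    refine ENNReal.tendsto_ofReal ?_
    have hc : ∀ s : ℝ, 0 < s → ContinuousAt (fun ε : ℝ => (s + ε) ^ p) 0 := fun s hs =>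
      ContinuousAt.rpow_const (by fun_prop) (Or.inl (by simpa using hs.ne'))
    have hF : Continuous fun w : ℝ × ℝ × ℝ => cqPowTrace a w.1 w.2.1 w.2.2 := by
      unfold cqPowTrace
      refine continuous_const.mul (Continuous.add ?_ ?_) <;>
        exact Continuous.rpow_const (by fun_prop) fun _ => Or.inr ha0.le
    have h0 := hc s₀ hs₀
    have h1 := hc s₁ hs₁
    have hG : ContinuousAt (fun ε : ℝ => (d₀ * ((s₀ + ε) ^ p) ^ 2, d₁ * ((s₁ + ε) ^ p) ^ 2,
        x * ((s₀ + ε) ^ p * (s₁ + ε) ^ p))) 0 := by fun_prop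
    have := (ContinuousAt.comp (f := fun ε : ℝ => (d₀ * ((s₀ + ε) ^ p) ^ 2,
      d₁ * ((s₁ + ε) ^ p) ^ 2, x * ((s₀ + ε) ^ p * (s₁ + ε) ^ p))) hF.continuousAt hG).tendsto
    simpa [Function.comp_def] using this

end Sandwiched

/-! ### Gaussian integrals, the error function and coherent overlaps -/

section Homodyne

theorem pi_rpow_neg_quarter_sq : (Real.pi ^ (-(1 / 4) : ℝ)) ^ 2 = (√Real.pi)⁻¹ := by
  rw [← Real.rpow_mul_natCast Real.pi_pos.le, Real.sqrt_eq_rpow, ← Real.rpow_neg Real.pi_pos.le]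
  norm_num

theorem integral_exp_neg_sq_Ioi : ∫ t in Set.Ioi (0 : ℝ), Real.exp (-t ^ 2) = √Real.pi / 2 := by
  simpa using integral_gaussian_Ioi 1

theorem integrable_exp_neg_sq : Integrable fun t : ℝ => Real.exp (-t ^ 2) := by
  simpa using integrable_exp_neg_mul_sq (b := 1) one_pos

theorem integral_exp_neg_sub_sq (b : ℝ) : ∫ q : ℝ, Real.exp (-(q - b) ^ 2) = √Real.pi := by
  rw [integral_sub_right_eq_self (fun t : ℝ => Real.exp (-t ^ 2)) b]
  simpa using integral_gaussian 1

theorem integral_interval_exp_neg_sq (b : ℝ) :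
    ∫ t in (0 : ℝ)..b, Real.exp (-t ^ 2) = √Real.pi / 2 * erf b := by
  have : √Real.pi ≠ 0 := (Real.sqrt_pos.2 Real.pi_pos).ne'
  rw [erf]
  field_simp

theorem integral_Ioi_exp_neg_sub_sq (b : ℝ) :
    ∫ q in Set.Ioi (0 : ℝ), Real.exp (-(q - b) ^ 2) = √Real.pi / 2 * (1 + erf b) := by
  have h := (measurePreserving_sub_right (volume : Measure ℝ) b).setIntegral_preimage_emb
    (measurableEmbedding_subRight b) (fun t => Real.exp (-t ^ 2)) (Set.Ioi (-b))
  have hs : (fun x => x - b) ⁻¹' Set.Ioi (-b) = Set.Ioi (0 : ℝ) := by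
    ext x; simp
  rw [hs] at h
  have hneg : ∫ t in (-b)..0, Real.exp (-t ^ 2) = ∫ t in (0 : ℝ)..b, Real.exp (-t ^ 2) := by
    have h0 := intervalIntegral.integral_comp_neg (a := 0) (b := b)
      fun t : ℝ => Real.exp (-t ^ 2)
    simp only [neg_sq, neg_zero] at h0
    exact h0.symm
  rw [h, ← intervalIntegral.integral_interval_add_Ioi integrable_exp_neg_sq.integrableOn
    integrable_exp_neg_sq.integrableOn (b := 0), hneg, integral_exp_neg_sq_Ioi,
    integral_interval_exp_neg_sq]
  ring

theorem integral_Iic_exp_neg_sub_sq (b : ℝ) :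
    ∫ q in Set.Iic (0 : ℝ), Real.exp (-(q - b) ^ 2) = √Real.pi / 2 * (1 - erf b) := by
  have hi : Integrable fun q : ℝ => Real.exp (-(q - b) ^ 2) := integrable_exp_neg_sq.comp_sub_right b
  have h := intervalIntegral.integral_Iic_add_Ioi (b := (0 : ℝ)) hi.integrableOn hi.integrableOn
  rw [integral_Ioi_exp_neg_sub_sq, integral_exp_neg_sub_sq] at h
  linarith

theorem erf_neg (x : ℝ) : erf (-x) = -erf x := by
  have h := intervalIntegral.integral_comp_neg (a := 0) (b := x) fun t : ℝ => Real.exp (-t ^ 2)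
  simp only [neg_sq, neg_zero] at h
  rw [erf, erf, h, intervalIntegral.integral_symm, mul_neg]

theorem erf_nonneg {x : ℝ} (hx : 0 ≤ x) : 0 ≤ erf x :=
  mul_nonneg (by positivity)
    (intervalIntegral.integral_nonneg hx fun t _ => (Real.exp_pos _).le)

/-- The Gaussian has positive mass on [x, x+1], so its integral from 0 to x is strictly less than
its integral over the half-line. -/
theorem erf_lt_one (x : ℝ) : erf x < 1 := by
  have h1 := intervalIntegral.integral_interval_add_Ioi (a := (0 : ℝ)) (b := x + 1)
    integrable_exp_neg_sq.integrableOn integrable_exp_neg_sq.integrableOn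
  have h2 := intervalIntegral.integral_add_adjacent_intervals (a := 0) (b := x) (c := x + 1)
    integrable_exp_neg_sq.intervalIntegrable integrable_exp_neg_sq.intervalIntegrable
  have h3 : 0 < ∫ t in x..(x + 1), Real.exp (-t ^ 2) :=
    intervalIntegral.intervalIntegral_pos_of_pos integrable_exp_neg_sq.intervalIntegrable
      (fun t => Real.exp_pos _) (by linarith)
  have h4 : 0 ≤ ∫ t in Set.Ioi (x + 1), Real.exp (-t ^ 2) :=
    integral_nonneg fun t => (Real.exp_pos _).le
  have hpi : 0 < √Real.pi := Real.sqrt_pos.2 Real.pi_pos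
  rw [integral_exp_neg_sq_Ioi] at h1
  rw [integral_interval_exp_neg_sq] at h2
  nlinarith

theorem homodyneProb_coherent (β : ℝ) (R : Set ℝ) :
    homodyneProb (coherent (β : ℂ)) R =
      (√Real.pi)⁻¹ * ∫ q in R, Real.exp (-(q - √2 * β) ^ 2) := by
  rw [homodyneProb, ← integral_const_mul]
  refine integral_congr_ae ?_
  filter_upwards [ae_restrict_of_ae (memLp_coherentFun (β : ℂ)).coeFn_toLp] with q hq
  rw [coherent, hq, norm_coherentFun_sq, pi_rpow_neg_quarter_sq, Complex.ofReal_re]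

theorem homodyneProb_coherent_region (β : ℝ) (y : Fin 2) :
    homodyneProb (coherent (β : ℂ)) (region y) = (1 + sign y * erf (√2 * β)) / 2 := by
  have hpi : √Real.pi ≠ 0 := (Real.sqrt_pos.2 Real.pi_pos).ne'
  rw [homodyneProb_coherent]
  fin_cases y
  · simp only [region, sign, Fin.zero_eta, if_true, integral_Ioi_exp_neg_sub_sq]
    field_simp
  · simp only [region, sign, Fin.mk_one, one_ne_zero, if_false, integral_Iic_exp_neg_sub_sq]
    field_simp
    ring

theorem coherentFun_ofReal (β q : ℝ) :
    coherentFun (β : ℂ) q =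
      ((Real.pi ^ (-(1 / 4) : ℝ) * Real.exp (-(q - √2 * β) ^ 2 / 2) : ℝ) : ℂ) := by
  have h2 : √2 ^ 2 = (2 : ℝ) := Real.sq_sqrt (by norm_num)
  have hn : ‖(β : ℂ)‖ ^ 2 = β ^ 2 := by rw [Complex.norm_real, Real.norm_eq_abs, sq_abs]
  have he : -(q - √2 * β) ^ 2 / 2 = -q ^ 2 / 2 + √2 * β * q - β ^ 2 / 2 - ‖(β : ℂ)‖ ^ 2 / 2 := by
    rw [hn]
    linear_combination -β ^ 2 / 2 * h2
  rw [coherentFun, he]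
  push_cast
  rfl

/-- Completing the square: the two half-exponents sum to a Gaussian centred at √2(β+γ)/2 times the
constant exp(-(β-γ)²/2). -/
theorem inner_coherent_ofReal (β γ : ℝ) :
    ⟪coherent (β : ℂ), coherent (γ : ℂ)⟫_ℂ = ((Real.exp (-(β - γ) ^ 2 / 2) : ℝ) : ℂ) := by
  have h2 : √2 ^ 2 = (2 : ℝ) := Real.sq_sqrt (by norm_num)
  have hpi : √Real.pi ≠ 0 := (Real.sqrt_pos.2 Real.pi_pos).ne'
  rw [L2.inner_def]
  have h : ∀ᵐ q : ℝ, ⟪coherent (β : ℂ) q, coherent (γ : ℂ) q⟫_ℂ =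
      (((√Real.pi)⁻¹ * Real.exp (-(β - γ) ^ 2 / 2) *
        Real.exp (-(q - √2 * ((β + γ) / 2)) ^ 2) : ℝ) : ℂ) := by
    filter_upwards [(memLp_coherentFun (β : ℂ)).coeFn_toLp,
      (memLp_coherentFun (γ : ℂ)).coeFn_toLp] with q hq hq'
    rw [coherent, coherent, hq, hq', coherentFun_ofReal, coherentFun_ofReal, RCLike.inner_apply,
      Complex.conj_ofReal, ← Complex.ofReal_mul, ← pi_rpow_neg_quarter_sq]
    congr 1
    have : Real.exp (-(β - γ) ^ 2 / 2) * Real.exp (-(q - √2 * ((β + γ) / 2)) ^ 2) =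
        Real.exp (-(q - √2 * β) ^ 2 / 2) * Real.exp (-(q - √2 * γ) ^ 2 / 2) := by
      rw [← Real.exp_add, ← Real.exp_add]
      congr 1
      linear_combination (β - γ) ^ 2 / 4 * h2
    linear_combination -(Real.pi ^ (-(1 / 4) : ℝ)) ^ 2 * this
  rw [integral_congr_ae h, integral_complex_ofReal, integral_const_mul, integral_exp_neg_sub_sq]
  congr 1
  field_simp

end Homodyne

/-! ### The protocol's states in the cat basis -/

section States

theorem bobProb_eq (α η : ℝ) (y x : Fin 2) :
    bobProb α η y x = (1 + sign y * sign x * erf (√(2 * η) * α)) / 2 := by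
  have h : √2 * (√η * amplitude α x) = sign x * (√(2 * η) * α) := by
    rw [Real.sqrt_mul (by norm_num), amplitude, sign]
    ring
  rw [bobProb, homodyneProb_coherent_region, h]
  fin_cases x <;> simp [sign, erf_neg]

/-- The normalized even and odd superpositions of the coherent states of amplitudes `±γ`, with
overlap `κ`. -/
def catState (γ κ : ℝ) : Fin 2 → Mode :=
  ![((√(2 * (1 + κ)))⁻¹ : ℂ) • (coherent (γ : ℂ) + coherent ((-γ : ℝ) : ℂ)),
    ((√(2 * (1 - κ)))⁻¹ : ℂ) • (coherent (γ : ℂ) - coherent ((-γ : ℝ) : ℂ))]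

variable {γ κ : ℝ}

theorem orthonormal_catState (hκ : κ = Real.exp (-2 * γ ^ 2)) (hκ1 : κ < 1) :
    Orthonormal ℂ (catState γ κ) := by
  have hκ0 : 0 < κ := hκ ▸ Real.exp_pos _
  have i00 : ⟪coherent (γ : ℂ), coherent (γ : ℂ)⟫_ℂ = 1 := by
    rw [inner_coherent_ofReal]; simp
  have i11 : ⟪coherent ((-γ : ℝ) : ℂ), coherent ((-γ : ℝ) : ℂ)⟫_ℂ = 1 := by
    rw [inner_coherent_ofReal]; simp
  have i01 : ⟪coherent (γ : ℂ), coherent ((-γ : ℝ) : ℂ)⟫_ℂ = κ := by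
    rw [inner_coherent_ofReal, hκ]; congr 2; ring
  have i10 : ⟪coherent ((-γ : ℝ) : ℂ), coherent (γ : ℂ)⟫_ℂ = κ := by
    rw [inner_coherent_ofReal, hκ]; congr 2; ring
  have hp : (√(2 * (1 + κ)) : ℂ) ^ 2 = 2 * (1 + κ) := by
    exact_mod_cast Real.sq_sqrt (show 0 ≤ 2 * (1 + κ) by linarith)
  have hm : (√(2 * (1 - κ)) : ℂ) ^ 2 = 2 * (1 - κ) := by
    exact_mod_cast Real.sq_sqrt (show 0 ≤ 2 * (1 - κ) by linarith)
  have hp0 : (√(2 * (1 + κ)) : ℂ) ≠ 0 := by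
    exact_mod_cast (Real.sqrt_pos.2 (show 0 < 2 * (1 + κ) by linarith)).ne'
  have hm0 : (√(2 * (1 - κ)) : ℂ) ≠ 0 := by
    exact_mod_cast (Real.sqrt_pos.2 (show 0 < 2 * (1 - κ) by linarith)).ne'
  rw [orthonormal_iff_ite]
  intro i j
  fin_cases i <;> fin_cases j <;>
    simp only [catState, Fin.zero_eta, Fin.mk_one, Fin.isValue, Matrix.cons_val_zero,
      Matrix.cons_val_one, inner_add_left, inner_add_right, inner_sub_left, inner_sub_right,
      inner_smul_left, inner_smul_right, i00, i01, i10, i11, map_inv₀, Complex.conj_ofReal,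
      zero_ne_one, one_ne_zero, if_true, if_false]
  · field_simp
    linear_combination -hp
  · ring
  · ring
  · field_simp
    linear_combination -hm

theorem coherent_sign (hκ0 : -1 < κ) (hκ1 : κ < 1) (x : Fin 2) :
    coherent ((sign x * γ : ℝ) : ℂ) = (√((1 + κ) / 2) : ℂ) • catState γ κ 0 +
      ((sign x * √((1 - κ) / 2) : ℝ) : ℂ) • catState γ κ 1 := by
  have key : ∀ t : ℝ, 0 < t → (√(t / 2) : ℂ) * (√(2 * t) : ℂ)⁻¹ = 1 / 2 := fun t ht => by
    have h0 : √(2 * t) ≠ 0 := (Real.sqrt_pos.2 (by linarith)).ne'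
    have : √(t / 2) * (√(2 * t))⁻¹ = 1 / 2 := by
      rw [← div_eq_mul_inv, ← Real.sqrt_div (by positivity)]
      rw [show t / 2 / (2 * t) = (1 / 2) ^ 2 by field_simp]
      exact Real.sqrt_sq (by norm_num)
    rw [← Complex.ofReal_inv, ← Complex.ofReal_mul, this]
    norm_num
  have hp := key (1 + κ) (by linarith)
  have hm := key (1 - κ) (by linarith)
  simp only [catState, Matrix.cons_val_zero, Matrix.cons_val_one, Complex.ofReal_mul, smul_smul,
    mul_assoc, hp, hm]
  fin_cases x
  · simp only [sign, pow_zero, one_mul, Complex.ofReal_one]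
    module
  · simp only [sign, pow_one, neg_mul, one_mul, Complex.ofReal_neg,
      Complex.ofReal_one]
    module

theorem proj_add_smul (e : Fin 2 → Mode) (c s : ℝ) :
    proj ((c : ℂ) • e 0 + (s : ℂ) • e 1) = symOp e (c ^ 2) (s ^ 2) (c * s) := by
  ext1 v
  rw [symOp_apply, proj, InnerProductSpace.rankOne_apply, inner_add_left, inner_smul_left,
    inner_smul_left, Complex.conj_ofReal, Complex.conj_ofReal]
  push_cast
  module

theorem symOp_add {H : Type*} [NormedAddCommGroup H] [InnerProductSpace ℂ H]
    [CompleteSpace H] (e : Fin 2 → H) (d₀ d₁ x d₀' d₁' x' : ℝ) :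
    symOp e d₀ d₁ x + symOp e d₀' d₁' x' = symOp e (d₀ + d₀') (d₁ + d₁') (x + x') := by
  simp only [symOp]
  push_cast
  module

theorem smul_symOp (e : Fin 2 → Mode) (t d₀ d₁ x : ℝ) :
    (t : ℂ) • symOp e d₀ d₁ x = symOp e (t * d₀) (t * d₁) (t * x) := by
  simp only [symOp]
  push_cast
  module

theorem smul_block {ι : Type*} [Fintype ι] (t : ℂ) (y : ι) (T : Mode →L[ℂ] Mode) :
    t • block y T = block y (t • T) := by
  ext1 x
  simp [block]

/-- The diagonal is common to both values of x and ∑ₓ p(y|x) = 1; the off-diagonal entry is scaled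
by ∑ₓ (-1)^x p(y|x) = (-1)^y r. -/
theorem rhoEgiven_eq {α η r : ℝ} (hr : r = erf (√(2 * η) * α)) (hγ : γ = √(1 - η) * α)
    (hκ0 : -1 < κ) (hκ1 : κ < 1) (y : Fin 2) :
    rhoEgiven α η y = symOp (catState γ κ) ((1 + κ) / 2) ((1 - κ) / 2)
      (sign y * (r * (√((1 + κ) / 2) * √((1 - κ) / 2)))) := by
  have he : ∀ x : Fin 2, eveState α η x = symOp (catState γ κ) ((1 + κ) / 2) ((1 - κ) / 2)
      (√((1 + κ) / 2) * (sign x * √((1 - κ) / 2))) := fun x => by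
    have h1 : √(1 - η) * amplitude α x = sign x * γ := by
      rw [hγ, amplitude, sign]; ring
    rw [eveState, h1, coherent_sign hκ0 hκ1, proj_add_smul, mul_pow, sign_sq, one_mul,
      Real.sq_sqrt (by linarith), Real.sq_sqrt (by linarith)]
  rw [rhoEgiven, Fin.sum_univ_two, bobProb_eq, bobProb_eq, he, he, smul_symOp, smul_symOp,
    symOp_add, ← hr]
  have s0 : sign 0 = 1 := by simp [sign]
  have s1 : sign 1 = -1 := by simp [sign]
  rw [s0, s1]
  congr 1 <;> ring

theorem rhoYE_eq {α η r : ℝ} (hr : r = erf (√(2 * η) * α)) (hγ : γ = √(1 - η) * α)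
    (hκ0 : -1 < κ) (hκ1 : κ < 1) :
    rhoYE α η = cqOp (catState γ κ) ((1 + κ) / 4) ((1 - κ) / 4)
      (r * (√((1 + κ) / 2) * √((1 - κ) / 2)) / 2) := by
  rw [rhoYE, cqOp, Finset.smul_sum]
  refine Finset.sum_congr rfl fun y _ => ?_
  rw [smul_block, rhoEgiven_eq hr hγ hκ0 hκ1,
    show (1 / 2 : ℂ) = ((1 / 2 : ℝ) : ℂ) by push_cast; rfl, smul_symOp]
  congr 2 <;> ring

theorem bra_comp_cqOp_comp_ket {H : Type*} [NormedAddCommGroup H] [InnerProductSpace ℂ H]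
    [CompleteSpace H] (e : Fin 2 → H) (d₀ d₁ x : ℝ) (y : Fin 2) :
    bra y ∘L cqOp e d₀ d₁ x ∘L ket y = symOp e d₀ d₁ (sign y * x) := by
  ext1 v
  simp only [cqOp, ContinuousLinearMap.comp_apply, sum_apply, map_sum, block]
  rw [Finset.sum_eq_single y]
  · simp [bra_apply, ket_apply]
  · intro j _ hj
    simp [bra_apply, ket_apply, hj]
  · simp

theorem partialTrace_cqOp {H : Type*} [NormedAddCommGroup H] [InnerProductSpace ℂ H]
    [CompleteSpace H] (e : Fin 2 → H) (d₀ d₁ x : ℝ) :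
    partialTrace (cqOp e d₀ d₁ x) = symOp e (2 * d₀) (2 * d₁) 0 := by
  rw [partialTrace]
  simp_rw [bra_comp_cqOp_comp_ket]
  rw [Fin.sum_univ_two, symOp_add]
  simp only [sign, Fin.val_zero, Fin.val_one]
  congr 1 <;> ring

end States

/-! ### Closed forms in hyperbolic functions -/

section Hyperbolic

theorem sech_pos (x : ℝ) : 0 < sech x := one_div_pos.2 (Real.cosh_pos x)

theorem one_add_tanh (x : ℝ) : 1 + Real.tanh x = sech x * Real.exp x := by
  have := (Real.cosh_pos x).ne'
  rw [Real.tanh_eq_sinh_div_cosh, sech, ← Real.cosh_add_sinh]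
  field_simp

theorem one_sub_tanh (x : ℝ) : 1 - Real.tanh x = sech x * Real.exp (-x) := by
  have := (Real.cosh_pos x).ne'
  rw [Real.tanh_eq_sinh_div_cosh, sech, ← Real.cosh_sub_sinh]
  field_simp

theorem mul_exp_rpow {w : ℝ} (hw : 0 ≤ w) (x a : ℝ) :
    (w * Real.exp x) ^ a = w ^ a * Real.exp (a * x) := by
  rw [Real.mul_rpow hw (Real.exp_pos _).le, ← Real.exp_mul, mul_comm a x]

theorem cosh_add_inv_mul_sinh_pos {g x : ℝ} (hg : 1 ≤ g) (hx : 0 ≤ x) :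
    0 < Real.cosh x + g⁻¹ * Real.sinh x ∧ 0 < Real.cosh x - g⁻¹ * Real.sinh x := by
  have h1 : 0 ≤ Real.sinh x := Real.sinh_nonneg_iff.2 hx
  have h2 : 0 < g⁻¹ := inv_pos.2 (by linarith)
  have h3 : g⁻¹ * Real.sinh x ≤ Real.sinh x := mul_le_of_le_one_left h1 (inv_le_one_of_one_le₀ hg)
  have h4 := Real.sinh_lt_cosh x
  have h5 := Real.cosh_pos x
  exact ⟨by positivity, by linarith⟩

/-- The weight of the spectral decomposition of `ρ_YE ^ a` on the first and the second vector of
the basis of Eve's qubit, for the angle `θ`. -/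
theorem weight_eq (a g θ : ℝ) :
    ((1 + Real.tanh θ) / 4) ^ a * (1 + g⁻¹) + ((1 - Real.tanh θ) / 4) ^ a * (1 - g⁻¹) =
        (sech θ / 4) ^ a * (2 * (Real.cosh (a * θ) + g⁻¹ * Real.sinh (a * θ))) ∧
      ((1 + Real.tanh θ) / 4) ^ a * (1 - g⁻¹) + ((1 - Real.tanh θ) / 4) ^ a * (1 + g⁻¹) =
        (sech θ / 4) ^ a * (2 * (Real.cosh (a * θ) - g⁻¹ * Real.sinh (a * θ))) := by
  have hs : 0 ≤ sech θ / 4 := by have := sech_pos θ; positivity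
  rw [one_add_tanh, one_sub_tanh, mul_div_right_comm, mul_div_right_comm, mul_exp_rpow hs,
    mul_exp_rpow hs, Real.cosh_eq, Real.sinh_eq, mul_neg]
  constructor <;> ring

theorem petz_down_value {a g θ φ : ℝ} :
    (sech θ / 4) ^ a * (2 * (Real.cosh (a * θ) + g⁻¹ * Real.sinh (a * θ))) *
          ((1 + Real.tanh φ) / 2) ^ (1 - a) +
        (sech θ / 4) ^ a * (2 * (Real.cosh (a * θ) - g⁻¹ * Real.sinh (a * θ))) *
          ((1 - Real.tanh φ) / 2) ^ (1 - a) =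
      2 ^ (1 - a) * (sech θ ^ a * sech φ ^ (1 - a) *
        (Real.cosh (a * θ) * Real.cosh ((1 - a) * φ)
          + g⁻¹ * Real.sinh (a * θ) * Real.sinh ((1 - a) * φ))) := by
  have hθ := (sech_pos θ).le
  have hφ := (sech_pos φ).le
  have h2 : (4 : ℝ) ^ a = 2 ^ a * 2 ^ a := by
    rw [← Real.mul_rpow zero_le_two zero_le_two]; norm_num
  have h3 : (2 : ℝ) ^ (1 - a) * 2 ^ a = 2 := by
    rw [← Real.rpow_add two_pos]; norm_num
  have h4 : (0 : ℝ) < 2 ^ a := by positivity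
  have h5 : (2 : ℝ) ^ (1 - a) = 2 / 2 ^ a := by rw [eq_div_iff h4.ne', h3]
  rw [one_add_tanh, one_sub_tanh, mul_div_right_comm, mul_div_right_comm,
    mul_exp_rpow (by positivity), mul_exp_rpow (by positivity), Real.div_rpow hθ (by norm_num),
    Real.div_rpow hφ (by norm_num), h2, h5, Real.cosh_eq ((1 - a) * φ), Real.sinh_eq ((1 - a) * φ),
    mul_neg]
  field_simp
  ring

theorem petz_up_value {a g θ : ℝ} (ha : 0 < a)
    (hp : 0 < Real.cosh (a * θ) + g⁻¹ * Real.sinh (a * θ))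
    (hm : 0 < Real.cosh (a * θ) - g⁻¹ * Real.sinh (a * θ)) :
    ((sech θ / 4) ^ a * (2 * (Real.cosh (a * θ) + g⁻¹ * Real.sinh (a * θ)))) ^ (1 / a) +
        ((sech θ / 4) ^ a * (2 * (Real.cosh (a * θ) - g⁻¹ * Real.sinh (a * θ)))) ^ (1 / a) =
      2 ^ (1 / a - 2) * sech θ *
        ((Real.cosh (a * θ) + g⁻¹ * Real.sinh (a * θ)) ^ (1 / a)
          + (Real.cosh (a * θ) - g⁻¹ * Real.sinh (a * θ)) ^ (1 / a)) := by
  have hs : 0 ≤ sech θ / 4 := by have := sech_pos θ; positivity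
  have h : ∀ u : ℝ, 0 < u →
      ((sech θ / 4) ^ a * (2 * u)) ^ (1 / a) = sech θ / 4 * (2 ^ (1 / a) * u ^ (1 / a)) :=
    fun u hu => by
      rw [Real.mul_rpow (by positivity) (by positivity), Real.mul_rpow zero_le_two hu.le,
        ← Real.rpow_mul hs, mul_one_div_cancel ha.ne', Real.rpow_one]
  have h2 : (2 : ℝ) ^ (1 / a - 2) = 2 ^ (1 / a) / 4 := by
    rw [Real.rpow_sub two_pos]; norm_num
  rw [h _ hp, h _ hm, h2]
  ring

theorem sandwiched_value {a r φ Δ : ℝ} (ha : 0 < a) (hr0 : 0 ≤ r) (hr1 : r < 1)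
    (hΔ : Δ = √(r ^ 2 + Real.sinh (φ / a) ^ 2)) :
    0 < (Real.cosh (φ / a) - Δ) ^ a + (Real.cosh (φ / a) + Δ) ^ a ∧
    cqPowTrace a
        ((1 + Real.tanh φ) / 4 * (((1 + Real.tanh φ) / 2) ^ ((1 - a) / (2 * a))) ^ 2)
        ((1 - Real.tanh φ) / 4 * (((1 - Real.tanh φ) / 2) ^ ((1 - a) / (2 * a))) ^ 2)
        (r * (√((1 + Real.tanh φ) / 2) * √((1 - Real.tanh φ) / 2)) / 2 *
          (((1 + Real.tanh φ) / 2) ^ ((1 - a) / (2 * a)) *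
            ((1 - Real.tanh φ) / 2) ^ ((1 - a) / (2 * a)))) =
      2 ^ (-a) * (sech φ *
        ((Real.cosh (φ / a) - Δ) ^ a + (Real.cosh (φ / a) + Δ) ^ a)) := by
  have hΔ0 : 0 ≤ Δ := hΔ ▸ Real.sqrt_nonneg _
  have hc := Real.cosh_pos (φ / a)
  -- Indeed cosh²(φ/a) - Δ² = 1 - r² > 0.
  have hΔc : Δ < Real.cosh (φ / a) := by
    rw [hΔ, Real.sqrt_lt' hc, Real.cosh_sq]
    nlinarith
  have hm : 0 < Real.cosh (φ / a) - Δ := sub_pos.2 hΔc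
  have hp : 0 < Real.cosh (φ / a) + Δ := by linarith
  refine ⟨by positivity, ?_⟩
  have hw : 0 < sech φ / 2 := half_pos (sech_pos φ)
  set w := sech φ / 2 with hwdef
  set K := w ^ (1 / a) / 2 with hK
  have hK0 : 0 < K := by positivity
  have e0 : (1 + Real.tanh φ) / 2 = w * Real.exp φ := by
    rw [one_add_tanh, mul_div_right_comm]
  have e1 : (1 - Real.tanh φ) / 2 = w * Real.exp (-φ) := by
    rw [one_sub_tanh, mul_div_right_comm]
  -- The exponents add up to 1 + (1-a)/a = 1/a. This explains the argument φ/a and the scale K,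
  -- which factors out of the whole matrix.
  have hpow : ∀ x : ℝ, w * Real.exp x / 2 * ((w * Real.exp x) ^ ((1 - a) / (2 * a))) ^ 2 =
      K * Real.exp (x / a) := fun x => by
    have hpos : 0 < w * Real.exp x := by positivity
    rw [← Real.rpow_mul_natCast hpos.le, div_mul_eq_mul_div, ← Real.rpow_one_add' hpos.le,
      show 1 + (1 - a) / (2 * a) * (2 : ℕ) = 1 / a by push_cast; field_simp; ring,
      mul_exp_rpow hw.le, hK, one_div_mul_eq_div]
    · ring
    · push_cast
      field_simp
      simpa using ha.ne'
  have hD0 : (1 + Real.tanh φ) / 4 * (((1 + Real.tanh φ) / 2) ^ ((1 - a) / (2 * a))) ^ 2 =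
      K * Real.exp (φ / a) := by
    rw [← hpow, ← e0]
    ring
  have hD1 : (1 - Real.tanh φ) / 4 * (((1 - Real.tanh φ) / 2) ^ ((1 - a) / (2 * a))) ^ 2 =
      K * Real.exp (-(φ / a)) := by
    rw [← neg_div, ← hpow, ← e1]
    ring
  have hX : r * (√((1 + Real.tanh φ) / 2) * √((1 - Real.tanh φ) / 2)) / 2 *
      (((1 + Real.tanh φ) / 2) ^ ((1 - a) / (2 * a)) *
        ((1 - Real.tanh φ) / 2) ^ ((1 - a) / (2 * a))) = K * r := by
    have hprod : w * Real.exp φ * (w * Real.exp (-φ)) = w ^ 2 := by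
      rw [mul_mul_mul_comm, ← Real.exp_add]
      simp [sq]
    rw [e0, e1, ← Real.sqrt_mul (by positivity), ← Real.mul_rpow (by positivity) (by positivity),
      hprod, Real.sqrt_sq hw.le, ← Real.rpow_natCast_mul hw.le, hK]
    have : w * w ^ (((2 : ℕ) : ℝ) * ((1 - a) / (2 * a))) = w ^ (1 / a) := by
      rw [← Real.rpow_one_add' hw.le]
      · congr 1
        push_cast
        field_simp
        ring
      · push_cast
        field_simp
        simpa using ha.ne'
    rw [← this]
    ring
  have hsqrt : √(((K * Real.exp (φ / a) - K * Real.exp (-(φ / a))) / 2) ^ 2 + (K * r) ^ 2) =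
      K * Δ := by
    rw [show ((K * Real.exp (φ / a) - K * Real.exp (-(φ / a))) / 2) ^ 2 + (K * r) ^ 2 =
      K ^ 2 * (r ^ 2 + Real.sinh (φ / a) ^ 2) by rw [Real.sinh_eq]; ring,
      Real.sqrt_mul (by positivity), Real.sqrt_sq hK0.le, hΔ]
  have hmean : (K * Real.exp (φ / a) + K * Real.exp (-(φ / a))) / 2 = K * Real.cosh (φ / a) := by
    rw [Real.cosh_eq]; ring
  have hKa : K ^ a = w * 2 ^ (-a) := by
    rw [hK, Real.div_rpow (by positivity) zero_le_two, ← Real.rpow_mul hw.le,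
      one_div_mul_cancel ha.ne', Real.rpow_one, Real.rpow_neg zero_le_two, div_eq_mul_inv]
  rw [hD0, hD1, hX, cqPowTrace, hsqrt, hmean, ← mul_sub, ← mul_add, Real.mul_rpow hK0.le hm.le,
    Real.mul_rpow hK0.le hp.le, hKa, hwdef]
  ring

end Hyperbolic

/-! ### Assembly of the three entropies -/

section Entropies

variable {H : Type*} [NormedAddCommGroup H] [InnerProductSpace ℂ H] [CompleteSpace H]
variable {e : Fin 2 → H}

/-- The three Rényi conditional entropies of the classical-quantum state whose conditional states
are `(1 ± κ Z ± r √(1 - κ ^ 2) X) / 2` in the orthonormal basis `e`. -/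
theorem renyi_entropies_cqOp (he : Orthonormal ℂ e) {a κ r g θ φ Δ : ℝ} (ha0 : 0 < a)
    (ha1 : a ≠ 1) (hκ0 : 0 < κ) (hκ1 : κ < 1) (hr0 : 0 ≤ r) (hr1 : r < 1)
    (hg : g = √(1 + ((κ ^ 2)⁻¹ - 1) * r ^ 2)) (hθ : θ = Real.artanh (κ * g))
    (hφ : φ = Real.artanh κ) (hΔ : Δ = √(r ^ 2 + Real.sinh (φ / a) ^ 2)) :
    petzDown a (cqOp e ((1 + κ) / 4) ((1 - κ) / 4)
      (r * (√((1 + κ) / 2) * √((1 - κ) / 2)) / 2)) =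
      ((1 + 1 / (1 - a) * Real.logb 2
        (sech θ ^ a * sech φ ^ (1 - a) *
          (Real.cosh (a * θ) * Real.cosh ((1 - a) * φ)
            + g⁻¹ * Real.sinh (a * θ) * Real.sinh ((1 - a) * φ))) : ℝ) : EReal) ∧
    petzUp a (cqOp e ((1 + κ) / 4) ((1 - κ) / 4)
      (r * (√((1 + κ) / 2) * √((1 - κ) / 2)) / 2)) =
      ((a / (1 - a) * Real.logb 2
        ((2 : ℝ) ^ (1 / a - 2) * sech θ *
          ((Real.cosh (a * θ) + g⁻¹ * Real.sinh (a * θ)) ^ (1 / a)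
            + (Real.cosh (a * θ) - g⁻¹ * Real.sinh (a * θ)) ^ (1 / a))) : ℝ) : EReal) ∧
    sandwichedDown a (cqOp e ((1 + κ) / 4) ((1 - κ) / 4)
      (r * (√((1 + κ) / 2) * √((1 - κ) / 2)) / 2)) =
      ((-(2 * a) / (1 - a) + 1 / (1 - a) * Real.logb 2
        ((2 : ℝ) ^ a * sech φ *
          ((Real.cosh (φ / a) - Δ) ^ a + (Real.cosh (φ / a) + Δ) ^ a)) : ℝ) : EReal) := by
  have hκ2 : κ ^ 2 < 1 := by nlinarith
  have hr2 : r ^ 2 < 1 := by nlinarith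
  have hinv : 1 ≤ (κ ^ 2)⁻¹ := (one_le_inv₀ (by positivity)).2 hκ2.le
  have hg1 : 1 ≤ g := by
    rw [hg, Real.one_le_sqrt]
    have := mul_nonneg (sub_nonneg.2 hinv) (sq_nonneg r)
    linarith
  have hg0 : 0 < g := by linarith
  -- The right-hand side is the squared Bloch length of ρ_{E|y}, so κg is that length; being below
  -- 1, it equals tanh θ.
  have hgsq : κ ^ 2 * g ^ 2 = κ ^ 2 + (1 - κ ^ 2) * r ^ 2 := by
    rw [hg, Real.sq_sqrt (by have := mul_nonneg (sub_nonneg.2 hinv) (sq_nonneg r); linarith)]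
    field_simp
  have hκg0 : 0 < κ * g := by positivity
  have hκg1 : κ * g < 1 := by
    have : (κ * g) ^ 2 < 1 := by rw [mul_pow, hgsq]; nlinarith
    nlinarith
  have htθ : Real.tanh θ = κ * g := hθ ▸ Real.tanh_artanh ⟨by linarith, hκg1⟩
  have htφ : Real.tanh φ = κ := hφ ▸ Real.tanh_artanh ⟨by linarith, hκ1⟩
  have hθ0 : 0 ≤ a * θ := mul_nonneg ha0.le (hθ ▸ Real.artanh_nonneg hκg0.le)
  obtain ⟨hp, hm⟩ := cosh_add_inv_mul_sinh_pos hg1 hθ0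
  set CS := √((1 + κ) / 2) * √((1 - κ) / 2) with hCS
  have hCS2 : CS ^ 2 = (1 - κ ^ 2) / 4 := by
    rw [hCS, mul_pow, Real.sq_sqrt (by linarith), Real.sq_sqrt (by linarith)]
    ring
  set ρ := cqOp e ((1 + κ) / 4) ((1 - κ) / 4) (r * CS / 2) with hρ
  have hd₀ : 0 ≤ (1 + κ) / 4 := by linarith
  have hd₁ : 0 ≤ (1 - κ) / 4 := by linarith
  have hx : (r * CS / 2) ^ 2 ≤ (1 + κ) / 4 * ((1 - κ) / 4) := by
    rw [div_pow, mul_pow, hCS2]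
    nlinarith
  have hR : κ * g / 4 = √((((1 + κ) / 4 - (1 - κ) / 4) / 2) ^ 2 + (r * CS / 2) ^ 2) := by
    rw [eq_comm, Real.sqrt_eq_iff_eq_sq (by positivity) (by positivity)]
    rw [div_pow (r * CS), mul_pow r, hCS2]
    linear_combination -hgsq / 16
  have hA := weight_eq a g θ
  set A₀ := (sech θ / 4) ^ a * (2 * (Real.cosh (a * θ) + g⁻¹ * Real.sinh (a * θ))) with hA₀
  set A₁ := (sech θ / 4) ^ a * (2 * (Real.cosh (a * θ) - g⁻¹ * Real.sinh (a * θ))) with hA₁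
  have hw : 0 < sech θ / 4 := by have := sech_pos θ; positivity
  have hA₀0 : 0 < A₀ := by positivity
  have hA₁0 : 0 < A₁ := by positivity
  have hpetz : ∀ S : H →L[ℂ] H, 0 ≤ S →
      trace (CFC.rpow (ρ) (a / 2) * oneTensor S * CFC.rpow (ρ) (a / 2)) =
        ENNReal.ofReal (A₀ * (inner ℂ (e 0) (S (e 0))).re + A₁ * (inner ℂ (e 1) (S (e 1))).re) := by
    intro S hS
    rw [hρ, trace_rpow_mul_oneTensor_mul_rpow_cqOp he hd₀ hd₁ hx hR (by positivity) ha0 hS,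
      ← hA.1, ← hA.2, htθ]
    have h1 : ((1 + κ) / 4 + (1 - κ) / 4) / 2 + κ * g / 4 = (1 + κ * g) / 4 := by ring
    have h2 : ((1 + κ) / 4 + (1 - κ) / 4) / 2 - κ * g / 4 = (1 - κ * g) / 4 := by ring
    have h3 : ((1 + κ) / 4 - (1 - κ) / 4) / 2 / (κ * g / 4) = g⁻¹ := by
      field_simp
      ring
    rw [h1, h2, h3]
  set σ := symOp e ((1 + κ) / 2) ((1 - κ) / 2) 0 with hσ
  have hpt : partialTrace (ρ) = σ := by
    rw [hρ, partialTrace_cqOp, hσ]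
    congr 1 <;> ring
  have hσ0 : σ (e 0) = (((1 + κ) / 2 : ℝ) : ℂ) • e 0 := by
    rw [hσ, symOp_apply_zero he]
    simp
  have hσ1 : σ (e 1) = (((1 - κ) / 2 : ℝ) : ℂ) • e 1 := by
    rw [hσ, symOp_apply_one he]
    simp
  have hσnn : 0 ≤ σ := by
    rw [hσ, symOp_eq_eigenSum (l₀ := (1 + κ) / 2) (l₁ := (1 - κ) / 2) (c := 1) (s := 0)
      (by ring) (by ring) (by ring)]
    refine eigenSum_nonneg fun k => ?_
    fin_cases k
    · change 0 ≤ (1 + κ) / 2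
      linarith
    · change 0 ≤ (1 - κ) / 2
      linarith
  have hs₀ : 0 < (1 + κ) / 2 := by linarith
  have hs₁ : 0 < (1 - κ) / 2 := by linarith
  have h1a : 1 - a ≠ 0 := sub_ne_zero.2 ha1.symm
  refine ⟨?_, ?_, ?_⟩
  · rw [petzDown, petzDiv, hpt, petzQ_oneTensor_of_eigenvectors he hpetz ha1 hσnn hs₀ hs₁ hσ0 hσ1,
      neg_renyi_ofReal a (by positivity)]
    have hv := petz_down_value (a := a) (g := g) (θ := θ) (φ := φ)
    have hpos : 0 < A₀ * ((1 + κ) / 2) ^ (1 - a) + A₁ * ((1 - κ) / 2) ^ (1 - a) := by positivity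
    rw [htφ, ← hA₀, ← hA₁] at hv
    rw [hv] at hpos ⊢
    -- The factor 2^(1-a) produces the leading 1 of the formula.
    rw [Real.logb_mul (by positivity) (pos_of_mul_pos_right hpos (by positivity)).ne',
      Real.logb_rpow two_pos (by norm_num), mul_add, one_div_mul_cancel h1a]
  · rw [petzUp_of_weights he hpetz ha0 ha1 hA₀0 hA₁0, hA₀, hA₁, petz_up_value ha0 hp hm]
  · obtain ⟨hY, hv⟩ := sandwiched_value (φ := φ) ha0 hr0 hr1 hΔ
    rw [htφ, ← hCS] at hv
    rw [sandwichedDown, sandwichedDiv, hpt, hρ,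
      sandwichedQ_cqOp he hd₀ hd₁ hx ha0 ha1 hσnn hs₀ hs₁ hσ0 hσ1, hv]
    have hW := mul_pos (sech_pos φ) hY
    rw [mul_assoc ((2 : ℝ) ^ a), neg_renyi_ofReal a (by positivity)]
    generalize sech φ * ((Real.cosh (φ / a) - Δ) ^ a + (Real.cosh (φ / a) + Δ) ^ a) = W at hW
    -- The trace carries 2^(-a) and the stated formula 2^a; the ratio 2^(-2a) is the term -2a/(1-a).
    rw [Real.logb_mul (by positivity) hW.ne', Real.logb_mul (by positivity) hW.ne',
      Real.logb_rpow two_pos (by norm_num), Real.logb_rpow two_pos (by norm_num)]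
    congr 1
    field_simp
    ring

end Entropies

end BPSK

end

theorem mainTheorem1 (α η a : ℝ) (hα : 0 < α) (hη0 : 0 ≤ η) (hη1 : η < 1)
    (ha0 : 0 < a) (ha1 : a ≠ 1)
    (κ r g θ φ Δ : ℝ)
    (hκ : κ = Real.exp (2 * α ^ 2 * (η - 1)))
    (hr : r = BPSK.erf (√(2 * η) * α))
    (hg : g = √(1 + ((κ ^ 2)⁻¹ - 1) * r ^ 2))
    (hθ : θ = Real.artanh (κ * g))
    (hφ : φ = Real.artanh κ)
    (hΔ : Δ = √(r ^ 2 + Real.sinh (φ / a) ^ 2)) :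
    BPSK.petzDown a (BPSK.rhoYE α η) =
      ((1 + 1 / (1 - a) * Real.logb 2
        (BPSK.sech θ ^ a * BPSK.sech φ ^ (1 - a) *
          (Real.cosh (a * θ) * Real.cosh ((1 - a) * φ)
            + g⁻¹ * Real.sinh (a * θ) * Real.sinh ((1 - a) * φ))) : ℝ) : EReal) ∧
    BPSK.petzUp a (BPSK.rhoYE α η) =
      ((a / (1 - a) * Real.logb 2
        ((2 : ℝ) ^ (1 / a - 2) * BPSK.sech θ *
          ((Real.cosh (a * θ) + g⁻¹ * Real.sinh (a * θ)) ^ (1 / a)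
            + (Real.cosh (a * θ) - g⁻¹ * Real.sinh (a * θ)) ^ (1 / a))) : ℝ) : EReal) ∧
    BPSK.sandwichedDown a (BPSK.rhoYE α η) =
      ((-(2 * a) / (1 - a) + 1 / (1 - a) * Real.logb 2
        ((2 : ℝ) ^ a * BPSK.sech φ *
          ((Real.cosh (φ / a) - Δ) ^ a + (Real.cosh (φ / a) + Δ) ^ a)) : ℝ) : EReal) := by
  have hκ0 : 0 < κ := hκ ▸ Real.exp_pos _
  have hκ1 : κ < 1 := by
    rw [hκ, Real.exp_lt_one_iff]
    exact mul_neg_of_pos_of_neg (by positivity) (by linarith)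
  have hr0 : 0 ≤ r := hr ▸ BPSK.erf_nonneg (by positivity)
  have hr1 : r < 1 := hr ▸ BPSK.erf_lt_one _
  -- With γ = √(1-η) α, κ is the overlap exp(-2γ²) of Eve's two states.
  have hκγ : κ = Real.exp (-2 * (√(1 - η) * α) ^ 2) := by
    rw [hκ, mul_pow, Real.sq_sqrt (by linarith)]
    congr 1
    ring
  rw [BPSK.rhoYE_eq hr rfl (by linarith) hκ1]
  exact BPSK.renyi_entropies_cqOp (BPSK.orthonormal_catState hκγ hκ1) ha0 ha1 hκ0 hκ1 hr0 hr1
    hg hθ hφ hΔ
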